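/- **Lemma 4.2.** All graphs are finite and simple. The *cube* $P_3(T)$ of a graph $T$ is the graph on the vertex set of $T$ in which two distinct vertices are adjacent if and only if their distance in $T$ is at most $3$; let $\mathbb{C}$ be the class of all graphs isomorphic to $P_3(T)$ for some tree $T$. The *deck* of a graph $G$ is the multiset of its cards, that is, of the isomorphism classes of the vertex-deleted subgraphs $G-v$, one for each vertex $v$ of $G$. Then $\mathbb{C}$ is recognizable: membership in $\mathbb{C}$ is determined by the deck. That is, if $G$ and $H$ are graphs with the same deck and $G$ has at least three vertices, then $G\in\mathbb{C}$ if and only if $H\in\mathbb{C}$. -/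

import Mathlib

namespace TreeCube

universe u v

/-- The `k`-th power `P_k(G)`: the graph on the same vertices in which two distinct vertices are
adjacent iff their distance in `G` is at most `k` (vertices in different components of `G` are at
distance `⊤`, hence not adjacent). -/
def power {V : Type u} (G : SimpleGraph V) (k : ℕ) : SimpleGraph V where
  Adj x y := x ≠ y ∧ G.edist x y ≤ k
  symm := ⟨fun x y h => ⟨h.1.symm, by rw [SimpleGraph.edist_comm]; exact h.2⟩⟩
  loopless := ⟨fun _ h => h.1 rfl⟩

/-- Membership in the class of all graphs that are isomorphic to the third power of some tree. -/
def IsCubeOfTree {V : Type u} (G : SimpleGraph V) : Prop :=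
  ∃ (U : Type u) (T : SimpleGraph U), T.IsTree ∧ Nonempty (G ≃g power T 3)

/-- Isomorphism of labelled graphs on the vertex sets `{0, …, n - 1}`, `n : ℕ`. -/
def isoSetoid : Setoid (Σ n : ℕ, SimpleGraph (Fin n)) where
  r A B := Nonempty (A.2 ≃g B.2)
  iseqv :=
    { refl := fun _ => ⟨SimpleGraph.Iso.refl⟩
      symm := fun ⟨e⟩ => ⟨e.symm⟩
      trans := fun ⟨e⟩ ⟨f⟩ => ⟨e.trans f⟩ }

/-- A finite unlabelled graph: an isomorphism class of finite graphs. -/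
def UnlabelledGraph : Type := Quotient isoSetoid

/-- The unlabelled graph (isomorphism class) of a graph on an arbitrary finite vertex type. -/
noncomputable def unlabelled {V : Type u} [Finite V] (G : SimpleGraph V) : UnlabelledGraph :=
  Quotient.mk isoSetoid ⟨Nat.card V, G.map (Finite.equivFin V).toEmbedding⟩

/-- Two finite graphs have the same underlying unlabelled graph iff they are isomorphic. -/
theorem unlabelled_eq_iff {V : Type u} {W : Type v} [Finite V] [Finite W]
    (G : SimpleGraph V) (H : SimpleGraph W) :
    unlabelled G = unlabelled H ↔ Nonempty (G ≃g H) := by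
  have eG := SimpleGraph.Iso.map (Finite.equivFin V) G
  have eH := SimpleGraph.Iso.map (Finite.equivFin W) H
  refine Quotient.eq.trans ⟨?_, ?_⟩
  · rintro ⟨e⟩
    exact ⟨(eG.trans e).trans eH.symm⟩
  · rintro ⟨e⟩
    exact ⟨(eG.symm.trans e).trans eH⟩

/-- The card of `G` at `x`: the unlabelled graph obtained by deleting the vertex `x` together with
all edges at `x`. -/
noncomputable def card {V : Type u} [Finite V] (G : SimpleGraph V) (x : V) : UnlabelledGraph :=
  unlabelled (G.induce {y : V | y ≠ x})

/-- The deck of `G`: the multiset of all cards of `G`, one for each vertex. -/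
noncomputable def deck {V : Type u} [Fintype V] (G : SimpleGraph V) : Multiset UnlabelledGraph :=
  (Finset.univ : Finset V).val.map (card G)

end TreeCube

/-!
If `G = P₃(T)` has a universal vertex, the card at that vertex determines `G`, and the deck shows
which card this is. Otherwise `T` has diameter at least seven. By Kelly's lemma the deck determines
how many `k`-cliques contain each vertex, hence which vertices are simplicial; in `G` these are
leaves of `T` at the ends of branches, so every card of `H` at a simplicial vertex has a cube root
of diameter at least six. It follows that `H` has two simplicial vertices `v`, `v'` at distance
greater than two. Cube roots of `H - v` and `H - v'` restrict to two cube roots of `H - v - v'`.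
Near a leaf at the end of a branch, two cube roots of the same graph agree up to exchanging twins,
so the neighbourhood of `v`, which is a ball of radius two in the second root, is such a ball in
some cube root of `H - v`, and `v` can be attached to the centre of the ball as a leaf. This fails
only if the neighbourhoods of `v` and `v'` are cross-linked, which the cube root of a third card
excludes, because `v` and `v'` are at distance at least seven in it.
-/

namespace TreeCube

open SimpleGraph

section TreeDistance

variable {V W : Type*} {T : SimpleGraph V} {a a' b b' c p q r s t u v v' w x y y' z : V}

theorem dist_le_one_iff (hT : T.Connected) : T.dist u v ≤ 1 ↔ v = u ∨ T.Adj u v := by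
  rw [Nat.le_one_iff_eq_zero_or_eq_one, hT.dist_eq_zero_iff, dist_eq_one_iff_adj, eq_comm]

theorem length_eq_dist (hT : T.IsAcyclic) {p : T.Walk u v} (hp : p.IsPath) :
    p.length = T.dist u v := by
  obtain ⟨q, hq, hlen⟩ := p.reachable.exists_path_of_dist
  rw [← hlen, Subtype.mk.inj ((hT.subsingleton_path u v).elim ⟨p, hp⟩ ⟨q, hq⟩)]

theorem dist_map {T' : SimpleGraph W} (hT : T.Connected) (hT' : T'.IsAcyclic) (f : T →g T')
    (hf : Function.Injective f) (u v : V) : T'.dist (f u) (f v) = T.dist u v := by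
  obtain ⟨p, hp, hlen⟩ := hT.exists_path_of_dist u v
  rw [← hlen, ← length_eq_dist hT' (hp.map hf), Walk.length_map]

theorem dist_eq_or_of_adj (hT : T.IsTree) (h : T.Adj c b) (u : V) :
    T.dist b u = T.dist c u + 1 ∨ T.dist b u + 1 = T.dist c u := by
  rw [T.dist_comm (u := b), T.dist_comm (u := c)]
  exact (hT.dist_eq_dist_add_one_of_adj u h).symm.imp_right Eq.symm

theorem exists_adj_dist_add_one (hT : T.Connected) (h : c ≠ u) :
    ∃ a, T.Adj c a ∧ T.dist a u + 1 = T.dist c u := by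
  obtain ⟨p, hp⟩ := hT.exists_walk_length_eq_dist c u
  cases p with
  | nil => exact absurd rfl h
  | @cons _ a _ hca p =>
    have hp' := dist_le p
    have htri := hT.dist_triangle (u := c) (v := a) (w := u)
    rw [Walk.length_cons] at hp
    rw [dist_eq_one_iff_adj.2 hca] at htri
    exact ⟨a, hca, by omega⟩

theorem eq_of_adj_of_dist_add_one (hT : T.IsTree) (ha : T.Adj c a) (hb : T.Adj c b)
    (hau : T.dist a u + 1 = T.dist c u) (hbu : T.dist b u + 1 = T.dist c u) : a = b := by
  have eq_snd : ∀ {d}, T.Adj c d → T.dist d u + 1 = T.dist c u →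
      ∀ p : T.Walk c u, p.IsPath → d = p.snd := by
    intro d hd hdu p hp
    obtain ⟨q, hq⟩ := hT.connected.exists_walk_length_eq_dist d u
    have hlen : (Walk.cons hd q).length = T.dist c u := by rw [Walk.length_cons, hq, hdu]
    rw [(hT.existsUnique_path c u).unique hp (Walk.isPath_of_length_eq_dist _ hlen),
      Walk.snd_cons]
  obtain ⟨p, hp, -⟩ := hT.connected.exists_path_of_dist c u
  exact (eq_snd ha hau p hp).trans (eq_snd hb hbu p hp).symm

theorem dist_eq_dist_add_one_of_adj_of_ne (hT : T.IsTree) (ha : T.Adj c a) (hb : T.Adj c b)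
    (hau : T.dist a u + 1 = T.dist c u) (hab : a ≠ b) : T.dist b u = T.dist c u + 1 :=
  (dist_eq_or_of_adj hT hb u).resolve_right fun h =>
    hab (eq_of_adj_of_dist_add_one hT ha hb hau h)

theorem dist_eq_add_of_adj (hT : T.IsTree) (hcb : T.Adj c b) (hbu : T.dist b u = T.dist c u + 1)
    (hbv : T.dist b v + 1 = T.dist c v) : T.dist u v = T.dist u c + T.dist c v := by
  induction hn : T.dist c v generalizing c b with
  | zero => omega
  | succ n ih =>
    by_cases hb : b = v
    · subst hb
      rw [T.dist_self] at hbv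
      rw [T.dist_comm (u := u), T.dist_comm (u := u)]; omega
    · obtain ⟨d, hbd, hdv⟩ := exists_adj_dist_add_one hT.connected hb
      have hcd : c ≠ d := by rintro rfl; omega
      have hdu := dist_eq_dist_add_one_of_adj_of_ne hT (u := u) hcb.symm hbd (by omega) hcd
      have := ih hbd hdu hdv (by omega)
      grind [SimpleGraph.dist_comm]

theorem dist_add_dist_le_or (hT : T.IsTree) (a b u v : V) :
    T.dist a b + T.dist u v ≤ T.dist a u + T.dist b v ∨
      T.dist a b + T.dist u v ≤ T.dist a v + T.dist b u := by
  induction hn : T.dist u v generalizing u with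
  | zero =>
    obtain rfl := hT.connected.dist_eq_zero_iff.1 hn
    have := hT.connected.dist_triangle (u := a) (v := u) (w := b)
    grind [SimpleGraph.dist_comm]
  | succ n ih =>
    obtain ⟨c, huc, hcv⟩ := exists_adj_dist_add_one hT.connected (c := u) (u := v)
      (by rintro rfl; simp at hn)
    have := hT.connected.dist_triangle (u := a) (v := u) (w := b)
    rcases dist_eq_or_of_adj hT huc a with ha | ha
    · have := dist_eq_add_of_adj hT huc ha hcv
      grind [SimpleGraph.dist_comm]
    rcases dist_eq_or_of_adj hT huc b with hb | hb
    · have := dist_eq_add_of_adj hT huc hb hcv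
      grind [SimpleGraph.dist_comm]
    have := ih c (by omega)
    grind [SimpleGraph.dist_comm]

theorem exists_dist_eq (hT : T.Connected) {k : ℕ} (h : k ≤ T.dist u v) :
    ∃ t, T.dist u t = k ∧ T.dist t v + k = T.dist u v := by
  induction k generalizing u with
  | zero => exact ⟨u, T.dist_self, rfl⟩
  | succ k ih =>
    obtain ⟨a, hua, hav⟩ := exists_adj_dist_add_one hT (c := u) (u := v)
      (by rintro rfl; simp at h)
    obtain ⟨t, hat, htv⟩ := ih (u := a) (by omega)
    have h1 := hT.dist_triangle (u := u) (v := a) (w := t)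
    have h2 := hT.dist_triangle (u := u) (v := t) (w := v)
    rw [dist_eq_one_iff_adj.2 hua] at h1
    exact ⟨t, by omega, by omega⟩

theorem dist_eq_two (hT : T.IsTree) (hza : T.Adj z a) (hab : T.Adj a b) (hbz : b ≠ z) :
    T.dist z b = 2 := by
  have h1 := dist_eq_or_of_adj hT hab z
  have h2 := hT.connected.pos_dist_of_ne hbz
  have h3 := dist_eq_one_iff_adj.2 hza
  grind [SimpleGraph.dist_comm]

theorem dist_eq_four (hT : T.IsTree) (hza : T.Adj z a) (haa : T.Adj a a') (ha'z : a' ≠ z)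
    (hzb : T.Adj z b) (hbb : T.Adj b b') (hb'z : b' ≠ z) (hab : a ≠ b) : T.dist a' b' = 4 := by
  have ha := dist_eq_two hT hza haa ha'z
  have hb := dist_eq_two hT hzb hbb hb'z
  have hba := dist_eq_dist_add_one_of_adj_of_ne hT hza hzb (u := a')
    (by rw [dist_eq_one_iff_adj.2 haa, ha]) hab
  rw [dist_eq_add_of_adj hT hzb hba (by rw [dist_eq_one_iff_adj.2 hbb, hb]), dist_comm, ha, hb]

theorem dist_le_two_of_adj (hT : T.IsTree) (hwb : T.Adj w b) (hwb' : T.Adj w b') (hne : b ≠ b')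
    (hb : T.dist b t ≤ 3) (hb' : T.dist b' t ≤ 3) : T.dist w t ≤ 2 := by
  by_contra! h
  exact hne (eq_of_adj_of_dist_add_one hT hwb hwb' (u := t)
    (by have := dist_eq_or_of_adj hT hwb t; omega) (by have := dist_eq_or_of_adj hT hwb' t; omega))

theorem dist_le_three_and_iff (hT : T.IsTree) (hpx : T.dist p x = 2) (hqx : T.dist q x = 2)
    (hpq : T.dist p q = 4) : T.dist p t ≤ 3 ∧ T.dist q t ≤ 3 ↔ T.dist x t ≤ 1 := by
  have := hT.connected.dist_triangle (u := p) (v := x) (w := t)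
  have := hT.connected.dist_triangle (u := q) (v := x) (w := t)
  have := dist_add_dist_le_or hT x t p q
  grind [SimpleGraph.dist_comm]

theorem even_dist_add_dist_add_dist (hT : T.IsTree) (u v w : V) :
    Even (T.dist u v + T.dist v w + T.dist u w) := by
  induction hn : T.dist v w generalizing v with
  | zero => rw [hT.connected.dist_eq_zero_iff.1 hn]; exact ⟨_, by ring⟩
  | succ n ih =>
    obtain ⟨a, hva, haw⟩ := exists_adj_dist_add_one hT.connected (c := v) (u := w)
      (by rintro rfl; simp at hn)
    have := dist_eq_or_of_adj hT hva u
    grind [SimpleGraph.dist_comm]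

theorem dist_eq_add_of_between (hT : T.IsTree) (hs : T.dist u s + T.dist s v = T.dist u v)
    (ht : T.dist u t + T.dist t v = T.dist u v) (hst : T.dist u s ≤ T.dist u t) :
    T.dist u t = T.dist u s + T.dist s t := by
  have := hT.connected.dist_triangle (u := u) (v := s) (w := t)
  have := dist_add_dist_le_or hT s t u v
  grind [SimpleGraph.dist_comm]

theorem eq_of_between (hT : T.IsTree) (hs : T.dist u s + T.dist s v = T.dist u v)
    (ht : T.dist u t + T.dist t v = T.dist u v) (hst : T.dist u s = T.dist u t) : s = t :=
  hT.connected.dist_eq_zero_iff.1 (by have := dist_eq_add_of_between hT hs ht hst.le; omega)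

theorem between_of_dist_le_three (hT : T.IsTree) (h : 5 ≤ T.dist p q) (hp : T.dist p t ≤ 3)
    (hq : T.dist q t ≤ 3) : T.dist p t + T.dist t q = T.dist p q := by
  have := hT.connected.dist_triangle (u := p) (v := t) (w := q)
  have := even_dist_add_dist_add_dist hT p t q
  grind [SimpleGraph.dist_comm]

theorem dist_le_five_of_ne (hT : T.IsTree) (hst : s ≠ t) (hps : T.dist p s ≤ 3)
    (hpt : T.dist p t ≤ 3) (hqs : T.dist q s ≤ 3) (hqt : T.dist q t ≤ 3) : T.dist p q ≤ 5 := by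
  by_contra! h
  have hs := between_of_dist_le_three hT h.le hps hqs
  have ht := between_of_dist_le_three hT h.le hpt hqt
  exact hst (eq_of_between hT hs ht (by grind [SimpleGraph.dist_comm]))

theorem dist_le_four_of_pairwise_ne (hT : T.IsTree) (hrs : r ≠ s) (hrt : r ≠ t) (hst : s ≠ t)
    (hpr : T.dist p r ≤ 3) (hps : T.dist p s ≤ 3) (hpt : T.dist p t ≤ 3)
    (hqr : T.dist q r ≤ 3) (hqs : T.dist q s ≤ 3) (hqt : T.dist q t ≤ 3) : T.dist p q ≤ 4 := by
  by_contra! h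
  have hr := between_of_dist_le_three hT h hpr hqr
  have hs := between_of_dist_le_three hT h hps hqs
  have ht := between_of_dist_le_three hT h hpt hqt
  have h1 := mt (eq_of_between hT hr hs) hrs
  have h2 := mt (eq_of_between hT hr ht) hrt
  have h3 := mt (eq_of_between hT hs ht) hst
  grind [SimpleGraph.dist_comm]

theorem dist_le_three_of_cross (hT : T.IsTree) (hfar : 7 ≤ T.dist v v')
    (hy : T.dist v y ≤ 3) (hy' : T.dist v' y' ≤ 3) (hvy' : T.dist v y' ≤ 5)
    (hv'y : T.dist v' y ≤ 5) : T.dist y y' ≤ 3 := by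
  have hbetween : T.dist v y + T.dist y v' = T.dist v v' := by
    have := hT.connected.dist_triangle (u := v) (v := y) (w := v')
    have := even_dist_add_dist_add_dist hT v y v'
    grind [SimpleGraph.dist_comm]
  have hbetween' : T.dist v y' + T.dist y' v' = T.dist v v' := by
    have := hT.connected.dist_triangle (u := v) (v := y') (w := v')
    have := even_dist_add_dist_add_dist hT v y' v'
    grind [SimpleGraph.dist_comm]
  have := dist_eq_add_of_between hT hbetween hbetween'
  grind [SimpleGraph.dist_comm]

theorem dist_le_diam_of_isTree [Finite V] (hT : T.IsTree) (u v : V) : T.dist u v ≤ T.diam :=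
  haveI := hT.connected.nonempty
  dist_le_diam (connected_iff_ediam_ne_top.1 hT.connected)

theorem exists_lt_dist_of_lt_diam (hT : T.IsTree) {n : ℕ} (h : 2 * n < T.diam) (c : V) :
    ∃ t, n < T.dist c t := by
  have := hT.connected.nonempty
  by_contra! hc
  obtain ⟨a, b, hab⟩ := T.exists_dist_eq_diam
  have := hT.connected.dist_triangle (u := a) (v := c) (w := b)
  have := hc a
  have := hc b
  grind [SimpleGraph.dist_comm]

theorem exists_forall_dist_le [Finite V] (hT : T.IsTree) {n : ℕ} (h : T.diam ≤ 2 * n) :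
    ∃ c, ∀ t, T.dist c t ≤ n := by
  have := hT.connected.nonempty
  obtain ⟨a, b, hab⟩ := T.exists_dist_eq_diam
  obtain ⟨c, hac, hcb⟩ := exists_dist_eq hT.connected (u := a) (v := b) (k := T.dist a b / 2)
    (by omega)
  refine ⟨c, fun t => ?_⟩
  have := dist_le_diam_of_isTree hT t a
  have := dist_le_diam_of_isTree hT t b
  have := dist_add_dist_le_or hT c t a b
  grind [SimpleGraph.dist_comm]

end TreeDistance

section Leaf

variable {V : Type*} {T : SimpleGraph V} {l x t : V}

/-- `l` is a leaf of `T` and `x` is its only neighbour. -/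
def IsLeafAt (T : SimpleGraph V) (l x : V) : Prop := ∀ s, T.Adj l s ↔ s = x

namespace IsLeafAt

theorem adj (hl : IsLeafAt T l x) : T.Adj l x := (hl x).2 rfl

theorem dist_eq (hl : IsLeafAt T l x) (hT : T.Connected) (ht : t ≠ l) :
    T.dist l t = T.dist x t + 1 := by
  obtain ⟨a, hla, hat⟩ := exists_adj_dist_add_one hT ht.symm
  rw [(hl a).1 hla] at hat
  exact hat.symm

theorem dist_le_two_iff (hl : IsLeafAt T l x) (hT : T.Connected) :
    T.dist l t ≤ 2 ↔ T.dist x t ≤ 1 := by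
  obtain rfl | ht := eq_or_ne t l
  · simp [dist_eq_one_iff_adj.2 hl.adj.symm]
  · rw [hl.dist_eq hT ht]; omega

theorem subsingleton_neighborSet (hl : IsLeafAt T l x) : (T.neighborSet l).Subsingleton :=
  fun a ha b hb => ((hl a).1 ha).trans ((hl b).1 hb).symm

theorem isTree_induce (hl : IsLeafAt T l x) (hT : T.IsTree) : (T.induce {l}ᶜ).IsTree where
  isAcyclic := hT.isAcyclic.induce _
  connected :=
    { preconnected := hT.connected.preconnected.induce_of_degree_eq_one fun v hv => by
        obtain rfl : v = l := by simpa using hv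
        exact hl.subsingleton_neighborSet
      nonempty := ⟨⟨x, hl.adj.ne'⟩⟩ }

theorem isTree_of_induce (hl : IsLeafAt T l x) (hT : (T.induce {l}ᶜ).IsTree) : T.IsTree where
  connected := by
    have reachable : ∀ t, T.Reachable x t := by
      intro t
      obtain rfl | ht := eq_or_ne t l
      · exact hl.adj.symm.reachable
      · exact (hT.connected.preconnected ⟨x, hl.adj.ne'⟩ ⟨t, ht⟩).map (Embedding.induce _).toHom
    exact (connected_iff_exists_forall_reachable T).2 ⟨x, reachable⟩
  isAcyclic := by
    classical
    intro u p hp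
    by_cases hlp : l ∈ p.support
    · have hc := hp.rotate hlp
      refine hc.snd_ne_penultimate (hl.subsingleton_neighborSet ?_ ?_)
      · exact Walk.adj_snd hc.not_nil
      · exact (Walk.adj_penultimate hc.not_nil).symm
    · have hmem : ∀ w ∈ p.support, w ∈ ({l}ᶜ : Set V) := by
        rintro w hw rfl
        exact hlp hw
      refine hT.isAcyclic (p.induce _ hmem)
        (Walk.IsCycle.of_map (f := (Embedding.induce _).toHom) ?_)
      rwa [Walk.map_induce]

end IsLeafAt

theorem dist_induce (hT : T.IsTree) {A : Set V} (hA : (T.induce A).Connected) (a b : A) :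
    (T.induce A).dist a b = T.dist a b :=
  (dist_map hA hT.isAcyclic (Embedding.induce A).toHom Subtype.val_injective a b).symm

theorem dist_comap_equiv (hT : T.IsTree) {W : Type*} (e : W ≃ V) (a b : W) :
    (T.comap e).dist a b = T.dist (e a) (e b) :=
  (dist_map ((Iso.comap e T).connected_iff.2 hT.connected) hT.isAcyclic (Iso.comap e T).toHom
    e.injective a b).symm

theorem IsLeafAt.diam_le [Finite V] (hl : IsLeafAt T l x) (hT : T.IsTree) :
    T.diam ≤ (T.induce {l}ᶜ).diam + 1 := by
  have := hT.connected.nonempty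
  have hT' := hl.isTree_induce hT
  have dist_le : ∀ a b, a ≠ l → b ≠ l → T.dist a b ≤ (T.induce {l}ᶜ).diam := fun a b ha hb => by
    rw [← dist_induce hT hT'.connected ⟨a, ha⟩ ⟨b, hb⟩]
    exact dist_le_diam_of_isTree hT' _ _
  have dist_leaf_le : ∀ b, T.dist l b ≤ (T.induce {l}ᶜ).diam + 1 := by
    intro b
    obtain rfl | hb := eq_or_ne b l
    · simp
    · rw [hl.dist_eq hT.connected hb]
      exact Nat.add_le_add_right (dist_le x b hl.adj.ne' hb) 1
  obtain ⟨a, b, hab⟩ := T.exists_dist_eq_diam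
  rw [← hab]
  by_cases ha : a = l
  · exact ha ▸ dist_leaf_le b
  by_cases hb : b = l
  · rw [hb, T.dist_comm]
    exact dist_leaf_le a
  · exact (dist_le a b ha hb).trans (Nat.le_succ _)

theorem diam_le_diam_comap_equiv [Finite V] (hT : T.IsTree) {W : Type*} (e : W ≃ V) :
    T.diam ≤ (T.comap e).diam := by
  have := hT.connected.nonempty
  have := Finite.of_equiv V e.symm
  obtain ⟨a, b, hab⟩ := T.exists_dist_eq_diam
  rw [← hab, ← e.apply_symm_apply a, ← e.apply_symm_apply b, ← dist_comap_equiv hT]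
  exact dist_le_diam_of_isTree ((Iso.comap e T).isTree_iff.2 hT) _ _

theorem IsLeafAt.comap {W : Type*} {l x : W} (e : W ≃ V) (h : IsLeafAt T (e l) (e x)) :
    IsLeafAt (T.comap e) l x := fun s =>
  (h (e s)).trans e.injective.eq_iff

theorem exists_adj_ne_of_not_isLeafAt (hlx : T.Adj l x) (hl : ¬IsLeafAt T l x) :
    ∃ s, T.Adj l s ∧ s ≠ x := by
  by_contra! h
  exact hl fun s => ⟨h s, by rintro rfl; exact hlx⟩

theorem exists_attach_leaf (v : V) {T : SimpleGraph ({v}ᶜ : Set V)} (x : ({v}ᶜ : Set V)) :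
    ∃ T' : SimpleGraph V, IsLeafAt T' v x ∧ T'.induce {v}ᶜ = T := by
  refine ⟨T.map (Function.Embedding.subtype _) ⊔ edge v x, fun s => ?_, ?_⟩
  · have := x.2
    simp only [sup_adj, map_adj, edge_adj, Function.Embedding.subtype_apply]
    grind
  · ext a b
    simp only [induce, comap_adj, sup_adj, map_adj, edge_adj, Function.Embedding.subtype_apply]
    grind

end Leaf

section CubeRoot

variable {V W : Type*} {T G : SimpleGraph V} {a b l u v w x : V}

/-- `T` is a cube root of `G`: a tree on the vertices of `G` whose cube is `G`. -/
structure IsCubeRoot (T G : SimpleGraph V) : Prop where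
  isTree : T.IsTree
  power_eq : power T 3 = G

/-- `v` is simplicial in `G`: its neighbours are pairwise adjacent. -/
def IsSimplicial (G : SimpleGraph V) (v : V) : Prop := G.IsClique (G.neighborSet v)

theorem IsSimplicial.adj (h : IsSimplicial G v) (ha : G.Adj v a) (hb : G.Adj v b) (hab : a ≠ b) :
    G.Adj a b := h ha hb hab

theorem IsSimplicial.induce (h : IsSimplicial G v) (A : Set V) (hv : v ∈ A) :
    IsSimplicial (G.induce A) ⟨v, hv⟩ := fun _ ha _ hb hab =>
  h.adj ha hb (Subtype.coe_injective.ne hab)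

theorem power_adj_iff (hT : T.Connected) {k : ℕ} :
    (power T k).Adj a b ↔ a ≠ b ∧ T.dist a b ≤ k := by
  rw [← Nat.cast_le (α := ℕ∞), (hT a b).coe_dist_eq_edist]
  rfl

theorem isCubeRoot_iff (hT : T.IsTree) :
    IsCubeRoot T G ↔ ∀ a b, a ≠ b → (G.Adj a b ↔ T.dist a b ≤ 3) := by
  constructor
  · rintro ⟨-, rfl⟩ a b hab
    rw [power_adj_iff hT.connected, and_iff_right hab]
  · intro h
    refine ⟨hT, ?_⟩
    ext a b
    rw [power_adj_iff hT.connected]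
    constructor
    · rintro ⟨hab, h'⟩
      exact (h a b hab).2 h'
    · exact fun h' => ⟨h'.ne, (h a b h'.ne).1 h'⟩

namespace IsCubeRoot

theorem adj_iff (r : IsCubeRoot T G) : G.Adj a b ↔ a ≠ b ∧ T.dist a b ≤ 3 := by
  rw [← power_adj_iff r.isTree.connected, r.power_eq]

theorem dist_le_three_iff (r : IsCubeRoot T G) : T.dist a b ≤ 3 ↔ a = b ∨ G.Adj a b := by
  rw [r.adj_iff]
  obtain rfl | h := eq_or_ne a b <;> simp [*]

theorem dist_le (r : IsCubeRoot T G) (h : G.Adj a b) : T.dist a b ≤ 3 := (r.adj_iff.1 h).2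

theorem lt_dist (r : IsCubeRoot T G) (hab : a ≠ b) (h : ¬G.Adj a b) : 3 < T.dist a b := by
  by_contra! h'
  exact h (r.adj_iff.2 ⟨hab, h'⟩)

theorem isSimplicial_iff (r : IsCubeRoot T G) :
    IsSimplicial G v ↔ ∀ a b, T.dist v a ≤ 3 → T.dist v b ≤ 3 → T.dist a b ≤ 3 := by
  simp only [r.dist_le_three_iff]
  constructor
  · rintro h a b (rfl | ha) (rfl | hb)
    · exact Or.inl rfl
    · exact Or.inr hb
    · exact Or.inr ha.symm
    · exact or_iff_not_imp_left.2 (h.adj ha hb)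
  · intro h a ha b hb hab
    exact (h a b (Or.inr ha) (Or.inr hb)).resolve_left hab

theorem isSimplicial_of_farthest (r : IsCubeRoot T G) (h : ∀ t, T.dist w t ≤ T.dist w u) :
    IsSimplicial G u := by
  refine r.isSimplicial_iff.2 fun a b ha hb => ?_
  have := h a
  have := h b
  have := dist_add_dist_le_or r.isTree a b u w
  grind [SimpleGraph.dist_comm]

theorem exists_isSimplicial_pair [Finite V] (r : IsCubeRoot T G) :
    ∃ a b, T.dist a b = T.diam ∧ IsSimplicial G a ∧ IsSimplicial G b := by
  have := r.isTree.connected.nonempty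
  obtain ⟨a, b, hab⟩ := T.exists_dist_eq_diam
  have dist_le := dist_le_diam_of_isTree r.isTree
  exact ⟨a, b, hab, r.isSimplicial_of_farthest fun t => (dist_le b t).trans (T.dist_comm ▸ hab.ge),
    r.isSimplicial_of_farthest fun t => (dist_le a t).trans hab.ge⟩

theorem seven_le_diam [Finite V] (r : IsCubeRoot T G)
    (hG : ∀ x, ¬G.IsUniversal x) : 7 ≤ T.diam := by
  by_contra! h
  obtain ⟨c, hc⟩ := exists_forall_dist_le r.isTree (n := 3) (by omega)
  exact hG c fun t hct => r.adj_iff.2 ⟨hct, hc t⟩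

theorem comap {G' : SimpleGraph W} (r : IsCubeRoot T G) (e : G' ≃g G) :
    IsCubeRoot (T.comap e) G' := by
  have hT : (T.comap e).IsTree := (Iso.comap e.toEquiv T).isTree_iff.2 r.isTree
  refine (isCubeRoot_iff hT).2 fun a b hab => ?_
  have hdist : (T.comap e).dist a b = T.dist (e a) (e b) := dist_comap_equiv r.isTree e.toEquiv a b
  rw [← e.map_adj_iff, r.adj_iff, hdist, and_iff_right (e.injective.ne hab)]

theorem induce (r : IsCubeRoot T G) (hl : IsLeafAt T l x) :
    IsCubeRoot (T.induce {l}ᶜ) (G.induce {l}ᶜ) := by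
  have hT := hl.isTree_induce r.isTree
  refine (isCubeRoot_iff hT).2 fun a b hab => ?_
  rw [dist_induce r.isTree hT.connected, induce_adj, r.adj_iff, and_iff_right]
  exact Subtype.coe_injective.ne hab

end IsCubeRoot

/-- `K` is the ball of radius `2` around a vertex of some cube root of `G`, so that a new vertex
with neighbourhood `K` can be attached to this root as a leaf. -/
def IsRootBall (G : SimpleGraph V) (K : Set V) : Prop :=
  ∃ T l, IsCubeRoot T G ∧ ∀ t, T.dist l t ≤ 2 ↔ t ∈ K

theorem IsRootBall.exists_isCubeRoot
    (h : IsRootBall (G.induce {v}ᶜ) (Subtype.val ⁻¹' G.neighborSet v)) :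
    ∃ T : SimpleGraph V, IsCubeRoot T G := by
  obtain ⟨T, l, r, h⟩ := h
  obtain ⟨T', hv, rfl⟩ := exists_attach_leaf v (T := T) l
  have hT' := hv.isTree_of_induce r.isTree
  have dist_eq := dist_induce hT' r.isTree.connected
  refine ⟨T', (isCubeRoot_iff hT').2 ?_⟩
  have adj_iff : ∀ t : ({v}ᶜ : Set V), G.Adj v t ↔ T'.dist v t ≤ 3 := by
    intro t
    change t ∈ Subtype.val ⁻¹' G.neighborSet v ↔ _
    rw [← h, dist_eq, hv.dist_eq hT'.connected t.2]
    omega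
  intro a b hab
  by_cases ha : a = v
  · subst ha
    exact adj_iff ⟨b, hab.symm⟩
  by_cases hb : b = v
  · subst hb
    rw [G.adj_comm, T'.dist_comm]
    exact adj_iff ⟨a, hab⟩
  have := r.adj_iff (a := ⟨a, ha⟩) (b := ⟨b, hb⟩)
  rw [dist_eq, and_iff_right fun h => hab (congrArg Subtype.val h)] at this
  exact this

theorem isCubeOfTree_iff : IsCubeOfTree G ↔ ∃ T : SimpleGraph V, IsCubeRoot T G := by
  constructor
  · rintro ⟨U, T, hT, ⟨e⟩⟩
    exact ⟨_, IsCubeRoot.comap ⟨hT, rfl⟩ e⟩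
  · rintro ⟨T, hT, rfl⟩
    exact ⟨V, T, hT, ⟨Iso.refl⟩⟩

end CubeRoot

section EndLeaf

variable {V : Type*} {T G : SimpleGraph V} {b q t u v w x y : V}

/-- `y, x, w` starts like a longest path of `T`: all neighbours of `x` other than `w` are leaves,
`y` among them, and the path extends by two more steps beyond `w`. The leaves `y` of this kind are
the simplicial vertices of the cube when the tree is large enough. -/
structure IsEndLeaf (T : SimpleGraph V) (y x w : V) : Prop where
  adj : T.Adj x y
  ne : y ≠ w
  adj_center : T.Adj x w
  isLeafAt_of_adj : ∀ ⦃s⦄, T.Adj x s → s ≠ w → IsLeafAt T s x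
  exists_dist_eq_two : ∃ t, T.dist w t = 2 ∧ T.dist x t = 3

theorem IsCubeRoot.exists_isEndLeaf (r : IsCubeRoot T G) (hv : IsSimplicial G v)
    (hvu : 4 ≤ T.dist v u) : ∃ y z, IsEndLeaf T v y z := by
  have hT := r.isTree
  have tri : ∀ a b c, T.dist a c ≤ T.dist a b + T.dist b c := fun _ _ _ =>
    hT.connected.dist_triangle
  obtain ⟨y, hvy, hyu⟩ := exists_adj_dist_add_one hT.connected (c := v) (u := u)
    (by rintro rfl; simp at hvu)
  obtain ⟨z, hyz, hzu⟩ := exists_adj_dist_add_one hT.connected (c := y) (u := u)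
    (by rintro rfl; simp at hyu; omega)
  obtain ⟨t, hzt, htu⟩ := exists_dist_eq hT.connected (u := z) (v := u) (k := 2) (by omega)
  obtain ⟨q, hzq, hqu⟩ := exists_dist_eq hT.connected (u := z) (v := u) (k := 1) (by omega)
  have hvy1 := dist_eq_one_iff_adj.2 hvy
  have hyz1 := dist_eq_one_iff_adj.2 hyz
  have hyq : T.dist y q = 2 := by have := tri y z q; have := tri y q u; omega
  have hvq : T.dist v q = 3 := by have := tri v y q; have := tri v q u; omega
  refine ⟨y, z, hvy.symm, by rintro rfl; omega, hyz, fun s hys hsz => ?_, t, hzt, ?_⟩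
  · have hsq := dist_eq_dist_add_one_of_adj_of_ne hT hyz hys (u := q) (by omega) hsz.symm
    refine fun s' => ⟨fun hss' => ?_, by rintro rfl; exact hys.symm⟩
    by_contra hs'y
    have hs'q := dist_eq_dist_add_one_of_adj_of_ne hT hys.symm hss' (u := q) (by omega)
      (Ne.symm hs'y)
    have hvs' := tri v y s'
    rw [dist_eq_two hT hys hss' hs'y] at hvs'
    have := r.isSimplicial_iff.1 hv s' q (by omega) hvq.le
    omega
  · have := tri y z t
    have := tri y t u
    omega

theorem IsCubeRoot.exists_isEndLeaf_of_diam (r : IsCubeRoot T G)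
    (hv : IsSimplicial G v) (h : 4 ≤ T.diam) : ∃ y z, IsEndLeaf T v y z := by
  have := r.isTree.connected.nonempty
  by_cases hu : ∃ u, 4 ≤ T.dist v u
  · exact r.exists_isEndLeaf hv hu.choose_spec
  · push Not at hu
    obtain ⟨a, b, hab⟩ := T.exists_dist_eq_diam
    have := r.isSimplicial_iff.1 hv a b (Nat.le_of_lt_succ (hu a)) (Nat.le_of_lt_succ (hu b))
    omega

namespace IsEndLeaf

theorem isLeafAt (e : IsEndLeaf T y x w) : IsLeafAt T y x := e.isLeafAt_of_adj e.adj e.ne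

theorem eq_or_adj_or_dist_eq (e : IsEndLeaf T y x w) (hT : T.IsTree) (t : V) :
    t = x ∨ (T.Adj x t ∧ t ≠ w) ∨ T.dist x t = T.dist w t + 1 := by
  by_cases ht : x = t
  · exact Or.inl ht.symm
  obtain ⟨a, hxa, hat⟩ := exists_adj_dist_add_one hT.connected ht
  by_cases haw : a = w
  · subst haw; exact Or.inr (Or.inr hat.symm)
  by_cases hta : t = a
  · subst hta; exact Or.inr (Or.inl ⟨hxa, haw⟩)
  · have := (e.isLeafAt_of_adj hxa haw).dist_eq hT.connected hta
    omega

theorem dist_le_three_iff (e : IsEndLeaf T y x w) (hT : T.IsTree) :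
    T.dist y q ≤ 3 ↔ (T.Adj x q ∧ q ≠ w) ∨ T.dist w q ≤ 1 := by
  have := e.eq_or_adj_or_dist_eq hT q
  have := hT.connected.dist_triangle (u := x) (v := w) (w := q)
  obtain rfl | hqy := eq_or_ne q y
  · simp [e.adj, e.ne]
  have := e.isLeafAt.dist_eq hT.connected hqy
  have := e.adj_center
  grind [dist_eq_one_iff_adj, SimpleGraph.dist_comm]

theorem isSimplicial (e : IsEndLeaf T y x w) (r : IsCubeRoot T G) : IsSimplicial G y := by
  have tri : ∀ a b c, T.dist a c ≤ T.dist a b + T.dist b c := fun _ _ _ =>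
    r.isTree.connected.dist_triangle
  refine r.isSimplicial_iff.2 fun a b ha hb => ?_
  rw [e.dist_le_three_iff r.isTree] at ha hb
  have := tri a x b
  have := tri a w b
  have := tri a x w
  have := tri w x b
  have := e.adj_center
  grind [dist_eq_one_iff_adj, SimpleGraph.dist_comm]

theorem not_adj_of_dist_le_one (e : IsEndLeaf T y x w) (hT : T.IsTree) (hq : T.dist w q ≤ 1) :
    ¬(T.Adj x q ∧ q ≠ w) := by
  rintro ⟨hxq, hqw⟩
  have := dist_eq_two hT e.adj_center.symm hxq hqw
  omega

theorem forall_dist_le_three_iff (e : IsEndLeaf T y x w) (hT : T.IsTree) :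
    (∀ t, T.dist q t ≤ 3 ↔ T.dist y t ≤ 3) ↔ T.Adj x q ∧ q ≠ w := by
  constructor
  · intro h
    have hyq := (h q).1 (by simp)
    refine ((e.dist_le_three_iff hT).1 hyq).resolve_right fun hwq => ?_
    obtain ⟨t, hwt, hxt⟩ := e.exists_dist_eq_two
    have := (e.dist_le_three_iff hT).1 ((h t).1 (by
      have := hT.connected.dist_triangle (u := q) (v := w) (w := t)
      grind [SimpleGraph.dist_comm]))
    grind [dist_eq_one_iff_adj]
  · rintro ⟨hxq, hqw⟩ t
    have hyq : T.dist y q ≤ 3 := (e.dist_le_three_iff hT).2 (Or.inl ⟨hxq, hqw⟩)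
    obtain rfl | htq := eq_or_ne t q
    · simp [hyq]
    obtain rfl | hty := eq_or_ne t y
    · simpa [T.dist_comm] using hyq
    rw [(e.isLeafAt_of_adj hxq hqw).dist_eq hT.connected htq, e.isLeafAt.dist_eq hT.connected hty]

theorem dist_parent_le_three_iff (e : IsEndLeaf T y x w) (hT : T.IsTree) :
    T.dist x t ≤ 3 ↔ T.dist w t ≤ 2 := by
  have := e.eq_or_adj_or_dist_eq hT t
  have := hT.connected.dist_triangle (u := x) (v := w) (w := t)
  have := hT.connected.dist_triangle (u := w) (v := x) (w := t)
  have := e.adj_center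
  grind [dist_eq_one_iff_adj, SimpleGraph.dist_comm]

theorem dist_center_le_two_iff (e : IsEndLeaf T y x w) (hT : T.IsTree) :
    T.dist w t ≤ 2 ↔ ∀ b, T.dist w b ≤ 1 → T.dist b t ≤ 3 := by
  constructor
  · intro h b hb
    have := hT.connected.dist_triangle (u := b) (v := w) (w := t)
    grind [SimpleGraph.dist_comm]
  · intro h
    obtain ⟨q, hwq, hxq⟩ := e.exists_dist_eq_two
    obtain ⟨s, hws, hsq⟩ := exists_adj_dist_add_one hT.connected (c := w) (u := q)
      (by rintro rfl; simp at hwq)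
    refine dist_le_two_of_adj hT e.adj_center.symm hws (by rintro rfl; omega) (h x ?_) (h s ?_)
    · exact (dist_eq_one_iff_adj.2 e.adj_center.symm).le
    · exact (dist_eq_one_iff_adj.2 hws).le

end IsEndLeaf

theorem IsCubeRoot.exists_isLeafAt (r : IsCubeRoot T G)
    (hx : IsSimplicial G x) (h : 4 ≤ T.diam) : ∃ p, IsLeafAt T x p := by
  obtain ⟨p, _, e⟩ := r.exists_isEndLeaf_of_diam hx h
  exact ⟨p, e.isLeafAt⟩

section TwoRoots

variable {T₁ T₂ : SimpleGraph V} {z m : V}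

theorem dist_le_three_congr (r₁ : IsCubeRoot T₁ G) (r₂ : IsCubeRoot T₂ G) :
    T₁.dist u v ≤ 3 ↔ T₂.dist u v ≤ 3 := by
  rw [r₁.dist_le_three_iff, r₂.dist_le_three_iff]

variable (r₁ : IsCubeRoot T₁ G) (r₂ : IsCubeRoot T₂ G) (e₁ : IsEndLeaf T₁ y x w)
  (e₂ : IsEndLeaf T₂ y z m)

include r₁ r₂ e₁ e₂

theorem sibling_iff : T₁.Adj x q ∧ q ≠ w ↔ T₂.Adj z q ∧ q ≠ m := by
  rw [← e₁.forall_dist_le_three_iff r₁.isTree, ← e₂.forall_dist_le_three_iff r₂.isTree]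
  simp only [dist_le_three_congr r₁ r₂]

theorem dist_center_le_one_iff : T₁.dist w q ≤ 1 ↔ T₂.dist m q ≤ 1 := by
  have := sibling_iff r₁ r₂ e₁ e₂ (q := q)
  have := e₁.dist_le_three_iff r₁.isTree (q := q)
  have := e₂.dist_le_three_iff r₂.isTree (q := q)
  have := e₁.not_adj_of_dist_le_one r₁.isTree (q := q)
  have := e₂.not_adj_of_dist_le_one r₂.isTree (q := q)
  have := dist_le_three_congr r₁ r₂ (u := y) (v := q)
  tauto

theorem dist_center_le_two_iff : T₁.dist w t ≤ 2 ↔ T₂.dist m t ≤ 2 := by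
  rw [e₁.dist_center_le_two_iff r₁.isTree, e₂.dist_center_le_two_iff r₂.isTree]
  simp only [dist_center_le_one_iff r₁ r₂ e₁ e₂, dist_le_three_congr r₁ r₂]

theorem dist_parent_le_three_congr : T₁.dist x t ≤ 3 ↔ T₁.dist z t ≤ 3 := by
  rw [dist_le_three_congr r₁ r₂ (u := z), e₁.dist_parent_le_three_iff r₁.isTree,
    e₂.dist_parent_le_three_iff r₂.isTree, dist_center_le_two_iff r₁ r₂ e₁ e₂]

theorem dist_center_add_one (hwm : w ≠ m) (h : 3 ≤ T₂.dist m t) :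
    T₂.dist w t + 1 = T₂.dist m t := by
  obtain ⟨b, hmb, hbt⟩ := exists_adj_dist_add_one r₂.isTree.connected (c := m) (u := t)
    (by rintro rfl; simp at h)
  by_cases hbw : b = w
  · rwa [hbw] at hbt
  -- Otherwise `b` and `m` are `T₁`-neighbours of `w`, and the vertex `s` two steps beyond `b`
  -- is within `T₁`-distance 3 of both, hence within 2 of `w`, hence within `T₂`-distance 2 of `m`.
  obtain ⟨s, hbs, hst⟩ := exists_dist_eq r₂.isTree.connected (u := b) (v := t) (k := 2) (by omega)
  have adj_center : ∀ q, q ≠ w → T₂.dist m q ≤ 1 → T₁.Adj w q := fun q hqw hmq =>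
    dist_eq_one_iff_adj.1 (le_antisymm ((dist_center_le_one_iff r₁ r₂ e₁ e₂).2 hmq)
      (r₁.isTree.connected.pos_dist_of_ne hqw.symm))
  have hms : T₂.dist m s = 3 := by
    have := r₂.isTree.connected.dist_triangle (u := m) (v := b) (w := s)
    have := r₂.isTree.connected.dist_triangle (u := m) (v := s) (w := t)
    grind [dist_eq_one_iff_adj]
  have hws := dist_le_two_of_adj r₁.isTree (t := s)
    (adj_center b hbw (dist_eq_one_iff_adj.2 hmb).le) (adj_center m hwm.symm (by simp)) hmb.ne'
    ((dist_le_three_congr r₁ r₂).2 (by omega)) ((dist_le_three_congr r₁ r₂).2 hms.le)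
  have := (dist_center_le_two_iff r₁ r₂ e₁ e₂).1 hws
  omega

theorem dist_center_le_three (hwm : w ≠ m) (u : V) : T₁.dist w u ≤ 3 := by
  by_contra! h
  obtain ⟨t, hwt, -⟩ := exists_dist_eq r₁.isTree.connected (u := w) (v := u) (k := 4) (by omega)
  have := dist_center_add_one r₂ r₁ e₂ e₁ hwm.symm (t := t) (by omega)
  have := dist_le_three_congr r₁ r₂ (u := m) (v := t)
  have := dist_center_le_two_iff r₁ r₂ e₁ e₂ (t := t)
  have := dist_center_add_one r₁ r₂ e₁ e₂ hwm (t := t) (by omega)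
  have := dist_le_three_congr r₁ r₂ (u := w) (v := t)
  omega

end TwoRoots

end EndLeaf

section Branching

variable {V : Type*} {T T₁ T₂ G : SimpleGraph V} {a a' b b' c x y z : V}

theorem ncard_neighborSet_add_one [Finite V] (hT : T.Connected) (x : V) :
    (T.neighborSet x).ncard + 1 = {t | T.dist x t ≤ 1}.ncard := by
  rw [← Set.ncard_insert_of_notMem (show x ∉ T.neighborSet x from T.irrefl)]
  congr 1
  ext t
  exact (dist_le_one_iff hT).symm

theorem exists_dist_le_one_iff (r₁ : IsCubeRoot T₁ G) (r₂ : IsCubeRoot T₂ G) (hza : T₂.Adj z a)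
    (haa' : T₂.Adj a a') (ha'z : a' ≠ z) (hzb : T₂.Adj z b) (hbb' : T₂.Adj b b') (hb'z : b' ≠ z)
    (hab : a ≠ b) : ∃ x, ∀ t, T₁.dist x t ≤ 1 ↔ T₂.dist z t ≤ 1 := by
  have ha'z2 : T₂.dist a' z = 2 := by rw [dist_comm]; exact dist_eq_two r₂.isTree hza haa' ha'z
  have hb'z2 : T₂.dist b' z = 2 := by rw [dist_comm]; exact dist_eq_two r₂.isTree hzb hbb' hb'z
  have hfour := dist_eq_four r₂.isTree hza haa' ha'z hzb hbb' hb'z hab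
  have hball : ∀ t, T₁.dist a' t ≤ 3 ∧ T₁.dist b' t ≤ 3 ↔ T₂.dist z t ≤ 1 := by
    intro t
    rw [dist_le_three_congr r₁ r₂, dist_le_three_congr r₁ r₂,
      dist_le_three_and_iff r₂.isTree ha'z2 hb'z2 hfour]
  have hfour' : T₁.dist a' b' = 4 := by
    have hz := (hball z).2 (by simp)
    have ha := (hball a).2 (dist_eq_one_iff_adj.2 hza).le
    have hb := (hball b).2 (dist_eq_one_iff_adj.2 hzb).le
    have hle := dist_le_four_of_pairwise_ne r₁.isTree hza.ne hzb.ne hab hz.1 ha.1 hb.1 hz.2 ha.2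
      hb.2
    have hlt := mt (dist_le_three_congr r₁ r₂ (u := a') (v := b')).1 (by omega)
    omega
  obtain ⟨x, hx, hx'⟩ := exists_dist_eq r₁.isTree.connected (u := a') (v := b') (k := 2) (by omega)
  refine ⟨x, fun t => ?_⟩
  rw [← hball, dist_le_three_and_iff r₁.isTree hx (by rw [dist_comm]; omega) hfour']

theorem exists_adj_and_adj_of_dist_eq_two (r₁ : IsCubeRoot T₁ G) (r₂ : IsCubeRoot T₂ G)
    (hball : ∀ t, T₁.dist x t ≤ 1 ↔ T₂.dist z t ≤ 1) (hza : T₂.Adj z a) (hzb : T₂.Adj z b)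
    (hab : a ≠ b) (hxc : T₁.dist x c = 2) : ∃ g, T₂.Adj z g ∧ T₂.Adj g c := by
  have dist_le_three : ∀ k, T₂.Adj z k → T₂.dist k c ≤ 3 := by
    intro k hk
    have hxk := (hball k).2 (dist_eq_one_iff_adj.2 hk).le
    have := r₁.isTree.connected.dist_triangle (u := k) (v := x) (w := c)
    rw [T₁.dist_comm] at hxk
    exact (dist_le_three_congr r₁ r₂).1 (by omega)
  have hle := dist_le_two_of_adj r₂.isTree hza hzb hab (dist_le_three a hza) (dist_le_three b hzb)
  have hlt := mt (hball c).2 (by omega)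
  obtain ⟨g, hzg, hgc⟩ := exists_adj_dist_add_one r₂.isTree.connected (c := z) (u := c)
    (by rintro rfl; simp at hlt)
  exact ⟨g, hzg, dist_eq_one_iff_adj.1 (by omega)⟩

theorem exists_isLeafAt_of_dist_le_one_iff [Finite V] (r₁ : IsCubeRoot T₁ G)
    (r₂ : IsCubeRoot T₂ G) (hball : ∀ t, T₁.dist x t ≤ 1 ↔ T₂.dist z t ≤ 1)
    (hza : T₂.Adj z a) (hzb : T₂.Adj z b) (hab : a ≠ b) (hy : IsLeafAt T₂ y z) :
    ∃ l, IsLeafAt T₁ l x := by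
  by_contra! hleaf
  -- Each neighbour `p` of `x` has a child `c p`, which in `T₂` is the child of a neighbour `g p`
  -- of `z` other than `y`; as `g` is injective, `x` has fewer neighbours than `z`.
  have exists_child : ∀ p ∈ T₁.neighborSet x, ∃ c, T₁.Adj p c ∧ c ≠ x := fun p hp =>
    exists_adj_ne_of_not_isLeafAt hp.symm (hleaf p)
  choose! c hpc hcx using exists_child
  have hxc : ∀ p ∈ T₁.neighborSet x, T₁.dist x (c p) = 2 := fun p hp =>
    dist_eq_two r₁.isTree hp (hpc p hp) (hcx p hp)
  choose! g hzg hgc using fun p hp =>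
    exists_adj_and_adj_of_dist_eq_two r₁ r₂ hball hza hzb hab (hxc p hp)
  have hg_inj : Set.InjOn g (T₁.neighborSet x) := by
    intro p hp q hq hpq
    by_contra hne
    have hfour := dist_eq_four r₁.isTree hp (hpc p hp) (hcx p hp) hq (hpc q hq) (hcx q hq) hne
    have hlt := mt (dist_le_three_congr r₁ r₂ (u := c p) (v := c q)).2 (by omega)
    have := r₂.isTree.connected.dist_triangle (u := c p) (v := g p) (w := c q)
    have := hgc p hp
    have := hgc q hq
    grind [dist_eq_one_iff_adj, SimpleGraph.dist_comm]
  have hg_ne : ∀ p ∈ T₁.neighborSet x, g p ≠ y := by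
    intro p hp hgy
    have hcz : c p = z := (hy _).1 (hgy ▸ hgc p hp)
    have := (hball (c p)).2 (by simp [hcz])
    have := hxc p hp
    omega
  have hle : (T₁.neighborSet x).ncard ≤ (T₂.neighborSet z \ {y}).ncard :=
    Set.ncard_le_ncard_of_injOn g (fun p hp => ⟨hzg p hp, hg_ne p hp⟩) hg_inj
  have hlt := Set.ncard_sdiff_singleton_lt_of_mem (s := T₂.neighborSet z) hy.adj.symm
  have hcard₁ := ncard_neighborSet_add_one r₁.isTree.connected x
  have hcard₂ := ncard_neighborSet_add_one r₂.isTree.connected z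
  simp only [hball] at hcard₁
  omega

theorem exists_isLeafAt_of_not_isLeafAt [Finite V] (r₁ : IsCubeRoot T₁ G)
    (r₂ : IsCubeRoot T₂ G) (hy : IsLeafAt T₂ y z) (hza : T₂.Adj z a) (ha : ¬IsLeafAt T₂ a z)
    (hzb : T₂.Adj z b) (hb : ¬IsLeafAt T₂ b z) (hab : a ≠ b) :
    ∃ l x, IsLeafAt T₁ l x ∧ ∀ t, T₁.dist x t ≤ 1 ↔ T₂.dist z t ≤ 1 := by
  obtain ⟨a', haa', ha'z⟩ := exists_adj_ne_of_not_isLeafAt hza.symm ha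
  obtain ⟨b', hbb', hb'z⟩ := exists_adj_ne_of_not_isLeafAt hzb.symm hb
  obtain ⟨x, hball⟩ := exists_dist_le_one_iff r₁ r₂ hza haa' ha'z hzb hbb' hb'z hab
  obtain ⟨l, hl⟩ := exists_isLeafAt_of_dist_le_one_iff r₁ r₂ hball hza hzb hab hy
  exact ⟨l, x, hl, hball⟩

end Branching

section Twins

variable {V : Type*} {G : SimpleGraph V} {v : V}

/-- `x` and `z` are twins in `G`: they have the same neighbours apart from each other. -/
def IsTwin (G : SimpleGraph V) (x z : V) : Prop := ∀ t, t ≠ x → t ≠ z → (G.Adj x t ↔ G.Adj z t)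

/-- The automorphism of `G` that exchanges two twins. -/
def IsTwin.swapIso [DecidableEq V] {x z : V} (h : IsTwin G x z) : G ≃g G where
  toEquiv := Equiv.swap x z
  map_rel_iff' := by
    intro a b
    have := h a
    have := h b
    grind [SimpleGraph.adj_comm, SimpleGraph.irrefl]

theorem IsTwin.of_induce {x z : ({v}ᶜ : Set V)} (h : IsTwin (G.induce {v}ᶜ) x z)
    (hx : ¬G.Adj v x) (hz : ¬G.Adj v z) : IsTwin G x z := by
  intro t htx htz
  obtain rfl | ht := eq_or_ne t v
  · exact iff_of_false (fun h => hx h.symm) (fun h => hz h.symm)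
  · exact h ⟨t, ht⟩ (fun h => htx (congrArg Subtype.val h)) fun h => htz (congrArg Subtype.val h)

theorem IsSimplicial.of_induce {u : ({v}ᶜ : Set V)} (hu : IsSimplicial (G.induce {v}ᶜ) u)
    (h : ¬G.Adj v u) : IsSimplicial G u := by
  have ne : ∀ a ∈ G.neighborSet u, a ≠ v := by
    rintro a ha rfl
    exact h ha.symm
  intro a ha b hb hab
  lift a to ({v}ᶜ : Set V) using ne a ha
  lift b to ({v}ᶜ : Set V) using ne b hb
  exact hu.adj ha hb fun h => hab (congrArg Subtype.val h)

end Twins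

section RootTwins

variable {V : Type*} {T₁ T₂ G : SimpleGraph V} {y x w z m t : V}

variable (r₁ : IsCubeRoot T₁ G) (r₂ : IsCubeRoot T₂ G) (e₁ : IsEndLeaf T₁ y x w)
  (e₂ : IsEndLeaf T₂ y z m)

include r₁ r₂ e₁ e₂

theorem isTwin_parent : IsTwin G x z := by
  intro t htx htz
  have := dist_parent_le_three_congr r₁ r₂ e₁ e₂ (t := t)
  simpa [r₁.dist_le_three_iff, htx.symm, htz.symm] using this

theorem isTwin_center : IsTwin G w m := by
  intro t htw htm
  obtain rfl | hwm := eq_or_ne w m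
  · rfl
  · have hw := r₁.dist_le_three_iff.1 (dist_center_le_three r₁ r₂ e₁ e₂ hwm t)
    have hm := r₂.dist_le_three_iff.1 (dist_center_le_three r₂ r₁ e₂ e₁ hwm.symm t)
    exact iff_of_true (hw.resolve_left htw.symm) (hm.resolve_left htm.symm)

theorem parent_ne_center (ht : 3 ≤ T₁.dist w t) : z ≠ w := by
  rintro rfl
  have := dist_center_le_three r₁ r₂ e₁ e₂ e₂.adj_center.ne t
  have := dist_parent_le_three_congr r₁ r₂ e₁ e₂ (t := t)
  have := e₁.dist_parent_le_three_iff r₁.isTree (t := t)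
  omega

theorem center_ne_parent (ht : 3 ≤ T₁.dist w t) : m ≠ x := by
  rintro rfl
  have := dist_center_le_three r₂ r₁ e₂ e₁ e₁.adj_center.ne t
  have := dist_le_three_congr r₁ r₂ (u := m) (v := t)
  have := e₁.dist_parent_le_three_iff r₁.isTree (t := t)
  omega

theorem dist_swap_swap_le_one_iff [DecidableEq V] (hzw : z ≠ w) (hmx : m ≠ x) :
    T₁.dist x (Equiv.swap x z (Equiv.swap w m t)) ≤ 1 ↔ T₂.dist z t ≤ 1 := by
  have := sibling_iff r₁ r₂ e₁ e₂ (q := t)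
  have := sibling_iff r₁ r₂ e₁ e₂ (q := x)
  have := sibling_iff r₁ r₂ e₁ e₂ (q := z)
  have := sibling_iff r₁ r₂ e₁ e₂ (q := w)
  have := sibling_iff r₁ r₂ e₁ e₂ (q := m)
  have := e₁.adj_center
  have := e₂.adj_center
  rw [dist_le_one_iff r₁.isTree.connected, dist_le_one_iff r₂.isTree.connected]
  grind [SimpleGraph.adj_comm, SimpleGraph.irrefl]

end RootTwins

section CrossLinked

variable {V : Type*} {T G : SimpleGraph V} {K N s : Set V} {v v' : V}

/-- The obstruction to `K` and `N` being neighbourhoods of two vertices that are far apart in a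
cube root of `G`: nonadjacent `y₁ ∈ K` and `y₂ ∈ N`, each with two neighbours in the other set. -/
def CrossLinked (G : SimpleGraph V) (K N : Set V) : Prop :=
  ∃ y₁ ∈ K, ∃ y₂ ∈ N, y₁ ≠ y₂ ∧ ¬G.Adj y₁ y₂ ∧
    (K ∩ G.neighborSet y₂).Nontrivial ∧ (N ∩ G.neighborSet y₁).Nontrivial

theorem IsCubeRoot.not_crossLinked (r : IsCubeRoot T G) (h : 7 ≤ T.dist v v') :
    ¬CrossLinked G (G.neighborSet v) (G.neighborSet v') := by
  rintro ⟨y₁, hy₁, y₂, hy₂, hne, hnadj, ⟨s, hs, s', hs', hss'⟩, ⟨t, ht, t', ht', htt'⟩⟩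
  refine hnadj (r.adj_iff.2 ⟨hne, dist_le_three_of_cross r.isTree h (r.dist_le hy₁) (r.dist_le hy₂)
    ?_ ?_⟩)
  · exact dist_le_five_of_ne r.isTree hss' (r.dist_le hs.1) (r.dist_le hs'.1) (r.dist_le hs.2)
      (r.dist_le hs'.2)
  · exact dist_le_five_of_ne r.isTree htt' (r.dist_le ht.1) (r.dist_le ht'.1) (r.dist_le ht.2)
      (r.dist_le ht'.2)

theorem crossLinked_induce_iff (hK : K ⊆ s) (hN : N ⊆ s) :
    CrossLinked (G.induce s) (Subtype.val ⁻¹' K) (Subtype.val ⁻¹' N) ↔ CrossLinked G K N := by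
  have nontrivial_iff : ∀ {L : Set V} {y : s}, L ⊆ s →
      ((Subtype.val ⁻¹' L ∩ (G.induce s).neighborSet y).Nontrivial ↔
        (L ∩ G.neighborSet y).Nontrivial) := by
    intro L y hL
    have himage : L ∩ G.neighborSet y =
        Subtype.val '' (Subtype.val ⁻¹' L ∩ (G.induce s).neighborSet y) := by
      ext t
      constructor
      · exact fun ht => ⟨⟨t, hL ht.1⟩, ht, rfl⟩
      · rintro ⟨t, ht, rfl⟩
        exact ht
    rw [himage, Set.image_nontrivial Subtype.val_injective]
  constructor
  · rintro ⟨y₁, hy₁, y₂, hy₂, hne, hnadj, h₁, h₂⟩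
    exact ⟨y₁, hy₁, y₂, hy₂, Subtype.coe_injective.ne hne, hnadj, (nontrivial_iff hK).1 h₁,
      (nontrivial_iff hN).1 h₂⟩
  · rintro ⟨y₁, hy₁, y₂, hy₂, hne, hnadj, h₁, h₂⟩
    exact ⟨⟨y₁, hK hy₁⟩, hy₁, ⟨y₂, hN hy₂⟩, hy₂, fun h => hne (congrArg Subtype.val h), hnadj,
      (nontrivial_iff hK).2 h₁, (nontrivial_iff hN).2 h₂⟩

end CrossLinked

section Glue

theorem IsLeafAt.exists_isEndLeaf {V : Type*} {T : SimpleGraph V} {y z u : V}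
    (hy : IsLeafAt T y z) (hT : T.IsTree) (hyu : 4 ≤ T.dist y u)
    (h : ∀ a b, T.Adj z a → ¬IsLeafAt T a z → T.Adj z b → ¬IsLeafAt T b z → a = b) :
    ∃ m, IsEndLeaf T y z m := by
  have hzu := hy.dist_eq hT.connected (t := u) (by rintro rfl; simp at hyu)
  obtain ⟨m, hzm, hmu⟩ := exists_adj_dist_add_one hT.connected (c := z) (u := u)
    (by rintro rfl; have := dist_eq_one_iff_adj.2 hy.adj; omega)
  obtain ⟨t, hmt, htu⟩ := exists_dist_eq hT.connected (u := m) (v := u) (k := 2) (by omega)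
  have hzt : T.dist z t = 3 := by
    have := hT.connected.dist_triangle (u := z) (v := m) (w := t)
    have := hT.connected.dist_triangle (u := z) (v := t) (w := u)
    have := dist_eq_one_iff_adj.2 hzm
    omega
  have hm : ¬IsLeafAt T m z := fun hm => by
    have := hm.dist_eq hT.connected (t := t) (by rintro rfl; simp at hmt)
    omega
  refine ⟨m, hy.adj.symm, by rintro rfl; exact hm hy, hzm, fun s hzs hsm => ?_, t, hmt, hzt⟩
  by_contra hs
  exact hsm (h s m hzs hs hzm hm)

variable {Y : Type*} {v p : Y} {G T₁ : SimpleGraph Y} {T₂ : SimpleGraph ({v}ᶜ : Set Y)}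
  {l u x y w z m : ({v}ᶜ : Set Y)} {K : Set Y}

theorem IsCubeRoot.isRootBall (r₁ : IsCubeRoot T₁ G) (hvK : v ∉ K) (hKv : ∀ t ∈ K, ¬G.Adj v t)
    (h : ∀ t : ({v}ᶜ : Set Y), T₁.dist l t ≤ 2 ↔ ↑t ∈ K) : IsRootBall G K := by
  refine ⟨T₁, l, r₁, fun t => ?_⟩
  obtain rfl | ht := eq_or_ne t v
  · have hlt := (r₁.dist_le_three_iff (a := t) (b := l)).not.2
      (not_or.2 ⟨Ne.symm l.2, hKv l ((h l).1 (by simp))⟩)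
    rw [T₁.dist_comm] at hlt
    exact iff_of_false (by omega) hvK
  · exact h ⟨t, ht⟩

variable (r₁ : IsCubeRoot T₁ G) (hv : IsLeafAt T₁ v p) (r₂ : IsCubeRoot T₂ (G.induce {v}ᶜ))
  (e₁ : IsEndLeaf (T₁.induce {v}ᶜ) y x w) (e₂ : IsEndLeaf T₂ y z m)
  (hK : ∀ t : ({v}ᶜ : Set Y), ↑t ∈ K ↔ T₂.dist z t ≤ 1) (hKv : ∀ t ∈ K, ¬G.Adj v t)

include r₁ hv r₂ e₁ e₂ hK hKv

theorem not_adj_parent (hvw : ¬G.Adj v w) : ¬G.Adj v x := by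
  intro hvx
  have hT := r₁.isTree
  have hxv := r₁.dist_le hvx.symm
  have hwv := r₁.lt_dist w.2 fun h => hvw h.symm
  obtain ⟨b, hxb, hbv⟩ := exists_adj_dist_add_one hT.connected (c := (x : Y)) (u := v) x.2
  have hwx : T₁.dist w x = 1 := dist_eq_one_iff_adj.2 e₁.adj_center.symm
  have := hT.connected.dist_triangle (u := (w : Y)) (v := x) (w := v)
  have hb : b ≠ v := by rintro rfl; simp at hbv; omega
  lift b to ({v}ᶜ : Set Y) using hb
  have hbw : b ≠ w := by rintro rfl; omega
  have hzb := ((sibling_iff (r₁.induce hv) r₂ e₁ e₂ (q := b)).1 ⟨hxb, hbw⟩).1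
  refine hKv b ((hK b).2 (dist_eq_one_iff_adj.2 hzb).le) (r₁.adj_iff.2 ⟨Ne.symm b.2, ?_⟩)
  rw [T₁.dist_comm]
  omega

theorem isRootBall_of_not_adj_center (hvK : v ∉ K) (hvw : ¬G.Adj v w) {t}
    (ht : 3 ≤ (T₁.induce {v}ᶜ).dist w t) : IsRootBall G K := by
  classical
  have s₁ := r₁.induce hv
  have hvx := not_adj_parent r₁ hv r₂ e₁ e₂ hK hKv hvw
  have hvz : ¬G.Adj v z := hKv z ((hK z).2 (by simp))
  have hvm : ¬G.Adj v m := hKv m ((hK m).2 (dist_eq_one_iff_adj.2 e₂.adj_center).le)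
  have hzw := parent_ne_center s₁ r₂ e₁ e₂ ht
  have hmx := center_ne_parent s₁ r₂ e₁ e₂ ht
  let φ : G ≃g G := (((isTwin_center s₁ r₂ e₁ e₂).of_induce hvw hvm).swapIso).trans
    (((isTwin_parent s₁ r₂ e₁ e₂).of_induce hvx hvz).swapIso)
  have hφ : ∀ t : ({v}ᶜ : Set Y), φ t = Equiv.swap x z (Equiv.swap w m t) := by
    intro t
    simp only [φ, RelIso.trans_apply]
    rw [← Subtype.val_injective.swap_apply, ← Subtype.val_injective.swap_apply]
    rfl
  have hφy : Equiv.swap x z (Equiv.swap w m y) = y := by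
    rw [Equiv.swap_apply_of_ne_of_ne e₁.ne e₂.ne,
      Equiv.swap_apply_of_ne_of_ne e₁.adj.ne' e₂.adj.ne']
  refine (r₁.comap φ).isRootBall (l := y) hvK hKv fun t => ?_
  have hdist : (T₁.comap φ).dist y t = T₁.dist (φ y) (φ t) :=
    dist_comap_equiv r₁.isTree φ.toEquiv y t
  rw [hdist, hφ, hφ, hφy, ← dist_induce r₁.isTree s₁.isTree.connected,
    e₁.isLeafAt.dist_le_two_iff s₁.isTree.connected, dist_swap_swap_le_one_iff s₁ r₂ e₁ e₂ hzw hmx,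
    hK]

theorem adj_center_center (hvw : G.Adj v w) :
    T₁.Adj w m ∧ T₁.dist w v = 3 ∧ T₁.dist m v = 4 := by
  have s₁ := r₁.induce hv
  have hmK : ↑m ∈ K := (hK m).2 (dist_eq_one_iff_adj.2 e₂.adj_center).le
  have hwm : w ≠ m := fun h => hKv m hmK (h ▸ hvw)
  have hwm' := (dist_le_one_iff s₁.isTree.connected).1
    ((dist_center_le_one_iff s₁ r₂ e₁ e₂ (q := m)).2 (by simp))
  have hadj : T₁.Adj w m := hwm'.resolve_left hwm.symm
  have hwv := r₁.dist_le hvw.symm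
  have hmv := r₁.lt_dist m.2 fun h => hKv m hmK h.symm
  have := dist_eq_or_of_adj r₁.isTree hadj v
  exact ⟨hadj, by omega, by omega⟩

theorem exists_path_of_adj_center (hvw : G.Adj v w) : ∃ z' y', T₁.Adj w z' ∧ T₁.Adj z' y' ∧
    y' ≠ w ∧ x ≠ z' ∧ G.Adj v z' ∧ G.Adj v y' := by
  obtain ⟨-, hwv, -⟩ := adj_center_center r₁ hv r₂ e₁ e₂ hK hKv hvw
  obtain ⟨z', hwz', hz'v⟩ := exists_adj_dist_add_one r₁.isTree.connected (c := (w : Y)) (u := v) w.2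
  obtain ⟨y', hz'y', hy'v⟩ := exists_adj_dist_add_one r₁.isTree.connected (c := z') (u := v)
    (by rintro rfl; simp at hz'v; omega)
  have hvz' : G.Adj v z' := (r₁.adj_iff.2 ⟨by rintro rfl; simp at hz'v; omega, by omega⟩).symm
  have hvy' : G.Adj v y' := (r₁.adj_iff.2 ⟨by rintro rfl; simp at hy'v; omega, by omega⟩).symm
  have hy'w : y' ≠ w := by rintro rfl; omega
  refine ⟨z', y', hwz', hz'y', hy'w, ?_, hvz', hvy'⟩
  rintro rfl
  lift y' to ({v}ᶜ : Set Y) using hvy'.ne'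
  have hzy' := (sibling_iff (r₁.induce hv) r₂ e₁ e₂ (q := y')).1
    ⟨hz'y', fun h => hy'w (congrArg _ h)⟩
  exact hKv y' ((hK y').2 (dist_eq_one_iff_adj.2 hzy'.1).le) hvy'

theorem crossLinked_of_adj_center (hvw : G.Adj v w) : CrossLinked G K (G.neighborSet v) := by
  have s₁ := r₁.induce hv
  have hT := r₁.isTree
  obtain ⟨hwm, -⟩ := adj_center_center r₁ hv r₂ e₁ e₂ hK hKv hvw
  obtain ⟨z', y', hwz', hz'y', hy'w, hxz', hvz', hvy'⟩ :=
    exists_path_of_adj_center r₁ hv r₂ e₁ e₂ hK hKv hvw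
  have hmK : ↑m ∈ K := (hK m).2 (dist_eq_one_iff_adj.2 e₂.adj_center).le
  have hzK : ↑z ∈ K := (hK z).2 (by simp)
  have hyK : ↑y ∈ K := (hK y).2 (dist_eq_one_iff_adj.2 e₂.adj).le
  have hwz : T₁.dist w z ≤ 1 := by
    rw [← dist_induce hT s₁.isTree.connected, dist_center_le_one_iff s₁ r₂ e₁ e₂]
    exact (dist_eq_one_iff_adj.2 e₂.adj_center.symm).le
  have hwm1 := dist_eq_one_iff_adj.2 hwm
  have hwz'1 := dist_eq_one_iff_adj.2 hwz'
  have hwy : T₁.dist w y = 2 :=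
    dist_eq_two hT e₁.adj_center.symm e₁.adj (Subtype.coe_injective.ne e₁.ne)
  have hwy' := dist_eq_two hT hwz' hz'y' hy'w
  have hyy' : T₁.dist y y' = 4 := dist_eq_four hT e₁.adj_center.symm e₁.adj
    (Subtype.coe_injective.ne e₁.ne) hwz' hz'y' hy'w hxz'
  have adj_of_dist : ∀ {a b : Y}, a ≠ b → T₁.dist w a + T₁.dist w b ≤ 3 → G.Adj a b := by
    intro a b hab h
    have := hT.connected.dist_triangle (u := a) (v := w) (w := b)
    rw [T₁.dist_comm (u := a) (v := w)] at this
    exact r₁.adj_iff.2 ⟨hab, by omega⟩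
  have ne_of_mem : ∀ {a b : Y}, a ∈ K → G.Adj v b → a ≠ b := by
    rintro a b ha hb rfl
    exact hKv a ha hb
  refine ⟨y, hyK, y', hvy', ne_of_mem hyK hvy', fun h => ?_,
    ⟨z, ⟨hzK, (adj_of_dist (ne_of_mem hzK hvy') (by omega)).symm⟩,
      m, ⟨hmK, (adj_of_dist (ne_of_mem hmK hvy') (by omega)).symm⟩,
      Subtype.coe_injective.ne e₂.adj_center.ne⟩,
    w, ⟨hvw, adj_of_dist (ne_of_mem hyK hvw) (by simp [hwy])⟩,
    z', ⟨hvz', adj_of_dist (ne_of_mem hyK hvz') (by omega)⟩, hwz'.ne⟩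
  have := r₁.dist_le h
  omega

theorem exists_isSimplicial_of_adj_center (hvw : G.Adj v w) {t}
    (ht : 3 ≤ (T₁.induce {v}ᶜ).dist w t) : ∃ u ≠ v, IsSimplicial G u ∧ u ∉ K ∧ ¬G.Adj v u := by
  have s₁ := r₁.induce hv
  have hS := s₁.isTree
  obtain ⟨hwm, hwv, hmv⟩ := adj_center_center r₁ hv r₂ e₁ e₂ hK hKv hvw
  have hne : w ≠ m := fun h => hwm.ne (congrArg _ h)
  have hwt := dist_center_le_three s₁ r₂ e₁ e₂ hne
  have hvt : ¬G.Adj v t := by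
    intro hvt
    have hmt := dist_center_add_one r₂ s₁ e₂ e₁ hne.symm ht
    rw [dist_induce r₁.isTree hS.connected] at ht
    rw [dist_induce r₁.isTree hS.connected, dist_induce r₁.isTree hS.connected] at hmt
    have := dist_eq_add_of_adj (u := v) (v := t) r₁.isTree hwm
      (by rw [hmv, hwv]) hmt
    have := r₁.dist_le hvt
    rw [T₁.dist_comm] at hwv
    omega
  have htsimp := s₁.isSimplicial_of_farthest fun s => (hwt s).trans ht
  refine ⟨t, t.2, htsimp.of_induce hvt, fun htK => ?_, hvt⟩
  have hball := dist_center_le_one_iff s₁ r₂ e₁ e₂ (q := t)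
  have hz := dist_center_le_one_iff s₁ r₂ e₁ e₂ (q := z)
  have hsib := sibling_iff s₁ r₂ e₁ e₂ (q := t)
  have htz := (dist_le_one_iff r₂.isTree.connected).1 ((hK t).1 htK)
  have := dist_eq_two hS e₁.adj_center.symm (b := t)
  have := e₂.adj_center
  grind [SimpleGraph.dist_comm, dist_eq_one_iff_adj]

omit e₁ e₂

theorem isRootBall_or_crossLinked [Finite Y] (hdiam : 6 ≤ T₁.diam) (hy : IsLeafAt T₂ y z)
    (hyu : 4 ≤ T₂.dist y u) (hvK : v ∉ K) : IsRootBall G K ∨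
      CrossLinked G K (G.neighborSet v) ∧ ∃ u ≠ v, IsSimplicial G u ∧ u ∉ K ∧ ¬G.Adj v u := by
  have s₁ := r₁.induce hv
  by_cases hbranch : ∃ a b, T₂.Adj z a ∧ ¬IsLeafAt T₂ a z ∧ T₂.Adj z b ∧ ¬IsLeafAt T₂ b z ∧ a ≠ b
  · obtain ⟨a, b, hza, ha, hzb, hb, hab⟩ := hbranch
    obtain ⟨l, x, hl, hball⟩ := exists_isLeafAt_of_not_isLeafAt s₁ r₂ hy hza ha hzb hb hab
    refine Or.inl (r₁.isRootBall (l := l) hvK hKv fun t => ?_)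
    rw [← dist_induce r₁.isTree s₁.isTree.connected, hl.dist_le_two_iff s₁.isTree.connected, hball,
      hK]
  push Not at hbranch
  obtain ⟨m, e₂⟩ := hy.exists_isEndLeaf r₂.isTree hyu hbranch
  obtain ⟨x, w, e₁⟩ := s₁.exists_isEndLeaf (e₂.isSimplicial r₂) (u := u)
    (by have := dist_le_three_congr s₁ r₂ (u := y) (v := u); omega)
  have := hv.diam_le r₁.isTree
  obtain ⟨t, ht⟩ := exists_lt_dist_of_lt_diam s₁.isTree (n := 2) (by omega) w
  by_cases hvw : G.Adj v w
  · exact Or.inr ⟨crossLinked_of_adj_center r₁ hv r₂ e₁ e₂ hK hKv hvw,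
      exists_isSimplicial_of_adj_center r₁ hv r₂ e₁ e₂ hK hKv hvw ht⟩
  · exact Or.inl (isRootBall_of_not_adj_center r₁ hv r₂ e₁ e₂ hK hKv hvK hvw ht)

end Glue

section AttachTwin

variable {V : Type*} {H : SimpleGraph V} {s v : V}

theorem IsSimplicial.of_isTwin (h : IsSimplicial H v) (hsv : IsTwin H s v) (hadj : H.Adj s v) :
    IsSimplicial H s := by
  have key : ∀ {a}, H.Adj s a → a ≠ v → H.Adj v a := fun ha hav => (hsv _ ha.ne' hav).1 ha
  intro a ha b hb hab
  obtain rfl | hav := eq_or_ne a v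
  · exact key hb hab.symm
  obtain rfl | hbv := eq_or_ne b v
  · exact (key ha hav).symm
  · exact h.adj (key ha hav) (key hb hbv) hab

theorem isRootBall_of_isTwin {T : SimpleGraph ({v}ᶜ : Set V)}
    (r : IsCubeRoot T (H.induce {v}ᶜ)) (h : 4 ≤ T.diam) (hv : IsSimplicial H v)
    (hsv : IsTwin H s v) (hadj : H.Adj s v) :
    IsRootBall (H.induce {v}ᶜ) (Subtype.val ⁻¹' H.neighborSet v) := by
  obtain ⟨y, z, e⟩ := r.exists_isEndLeaf_of_diam
    ((hv.of_isTwin hsv hadj).induce {v}ᶜ hadj.ne) h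
  refine ⟨T, y, r, fun t => ?_⟩
  have hst := r.dist_le_three_iff (a := ⟨s, hadj.ne⟩) (b := t)
  obtain rfl | hts := eq_or_ne t ⟨s, hadj.ne⟩
  · exact iff_of_true (dist_eq_one_iff_adj.2 e.adj |>.le.trans one_le_two) hadj.symm
  · rw [e.isLeafAt.dist_eq r.isTree.connected hts, or_iff_right hts.symm] at hst
    have hsv : H.Adj s t ↔ H.Adj v t := hsv t (fun h => hts (Subtype.ext h)) t.2
    exact Nat.succ_le_succ_iff.symm.trans (hst.trans hsv)

end AttachTwin

section DeleteTwo

variable {V : Type*} {H T : SimpleGraph V} {v v' : V}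

/-- Deleting two distinct vertices in either order yields the same graph. -/
def deleteComm (H : SimpleGraph V) (hne : v ≠ v') :
    (H.induce {v}ᶜ).induce {⟨v', hne.symm⟩}ᶜ ≃g (H.induce {v'}ᶜ).induce {⟨v, hne⟩}ᶜ where
  toFun t := ⟨⟨t, fun h => t.2 (Subtype.ext h)⟩, fun h => t.1.2 (congrArg Subtype.val h)⟩
  invFun t := ⟨⟨t, fun h => t.2 (Subtype.ext h)⟩, fun h => t.1.2 (congrArg Subtype.val h)⟩
  map_rel_iff' := Iff.rfl

/-- `v` and `v'` are simplicial vertices of `H` at distance greater than two. -/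
structure IsFarPair (H : SimpleGraph V) (v v' : V) : Prop where
  isSimplicial_left : IsSimplicial H v
  isSimplicial_right : IsSimplicial H v'
  ne : v ≠ v'
  not_adj : ¬H.Adj v v'
  not_adj_of_adj : ∀ ⦃t⦄, H.Adj v t → ¬H.Adj v' t

/-- Every card of `H` at a simplicial vertex has a cube root of diameter at least six. -/
def HasSimplicialCardRoots (H : SimpleGraph V) : Prop :=
  ∀ v, IsSimplicial H v → ∃ T, IsCubeRoot T (H.induce {v}ᶜ) ∧ 6 ≤ T.diam

theorem IsFarPair.seven_le_dist (h : IsFarPair H v v') (r : IsCubeRoot T H) : 7 ≤ T.dist v v' := by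
  by_contra! hlt
  obtain ⟨t, hvt, htv'⟩ := exists_dist_eq r.isTree.connected (u := v) (v := v') (k := 3)
    (r.lt_dist h.ne h.not_adj).le
  have hvt' : H.Adj v t := r.adj_iff.2 ⟨by rintro rfl; simp at hvt, hvt.le⟩
  refine h.not_adj_of_adj hvt' (H.adj_symm (r.adj_iff.2 ⟨?_, by omega⟩))
  rintro rfl
  exact h.not_adj hvt'

theorem IsFarPair.of_induce {u : V} {v v' : ({u}ᶜ : Set V)} (h : IsFarPair H v v') :
    IsFarPair (H.induce {u}ᶜ) v v' where
  isSimplicial_left := h.isSimplicial_left.induce _ v.2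
  isSimplicial_right := h.isSimplicial_right.induce _ v'.2
  ne := fun hvv' => h.ne (congrArg _ hvv')
  not_adj := h.not_adj
  not_adj_of_adj := fun _ => h.not_adj_of_adj (t := _)

namespace IsEndLeaf

variable {y z : V} (e : IsEndLeaf T v y z)
include e

theorem dist_induce_center_le_one_iff (h : ∀ s, T.Adj y s → s ≠ z → s = v) (r : IsCubeRoot T H)
    (t : ({v}ᶜ : Set V)) :
    (T.induce {v}ᶜ).dist ⟨z, e.ne.symm⟩ t ≤ 1 ↔ H.Adj v t := by
  rw [dist_induce r.isTree (e.isLeafAt.isTree_induce r.isTree).connected, r.adj_iff,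
    and_iff_right (Ne.symm t.2), e.dist_le_three_iff r.isTree]
  exact (or_iff_right fun ht => t.2 (h t ht.1 ht.2)).symm

theorem isLeafAt_induce (h : ∀ s, T.Adj y s → s ≠ z → s = v) :
    IsLeafAt (T.induce {v}ᶜ) ⟨y, e.adj.ne⟩ ⟨z, e.ne.symm⟩ := fun s => by
  constructor
  · exact fun hs => by_contra fun hsz => s.2 (h s hs fun heq => hsz (Subtype.ext heq))
  · rintro rfl
    exact e.adj_center

theorem exists_four_le_dist_induce [Finite V] (h : ∀ s, T.Adj y s → s ≠ z → s = v) (hT : T.IsTree)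
    (hdiam : 6 ≤ T.diam) : ∃ u, 4 ≤ (T.induce {v}ᶜ).dist ⟨y, e.adj.ne⟩ u := by
  have hS := e.isLeafAt.isTree_induce hT
  have hy := e.isLeafAt_induce h
  have := e.isLeafAt.diam_le hT
  obtain ⟨u, hu⟩ := exists_lt_dist_of_lt_diam hS (n := 2) (by omega) ⟨z, e.ne.symm⟩
  refine ⟨u, ?_⟩
  rw [hy.dist_eq hS.connected]
  · omega
  · rintro rfl
    have := dist_eq_one_iff_adj.2 hy.adj.symm
    omega

end IsEndLeaf

theorem IsFarPair.isRootBall_or [Finite V] (h : IsFarPair H v v')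
    {T₁ : SimpleGraph ({v}ᶜ : Set V)} (r₁ : IsCubeRoot T₁ (H.induce {v}ᶜ)) (h₁ : 6 ≤ T₁.diam)
    {T₂ : SimpleGraph ({v'}ᶜ : Set V)} (r₂ : IsCubeRoot T₂ (H.induce {v'}ᶜ)) (h₂ : 6 ≤ T₂.diam)
    {y z} (e : IsEndLeaf T₂ ⟨v, h.ne⟩ y z) (hyz : ∀ s, T₂.Adj y s → s ≠ z → s = ⟨v, h.ne⟩) :
    let K : Set ({v}ᶜ : Set V) := Subtype.val ⁻¹' H.neighborSet v
    IsRootBall (H.induce {v}ᶜ) K ∨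
      CrossLinked (H.induce {v}ᶜ) K (Subtype.val ⁻¹' H.neighborSet v') ∧
        ∃ u ≠ ⟨v', h.ne.symm⟩, IsSimplicial (H.induce {v}ᶜ) u ∧ u ∉ K ∧ ¬H.Adj v' u := by
  let φ := deleteComm H h.ne
  obtain ⟨_, _, e'⟩ := r₁.exists_isEndLeaf_of_diam
    (h.isSimplicial_right.induce {v}ᶜ h.ne.symm) (by omega)
  have s₂ := r₂.induce e.isLeafAt
  have dist_eq := dist_comap_equiv s₂.isTree φ.toEquiv
  obtain ⟨u, hu⟩ := e.exists_four_le_dist_induce hyz r₂.isTree h₂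
  refine isRootBall_or_crossLinked (G := H.induce {v}ᶜ) (v := ⟨v', h.ne.symm⟩)
    (y := φ.symm ⟨y, e.adj.ne⟩) (z := φ.symm ⟨z, e.ne.symm⟩) (u := φ.symm u)
    r₁ e'.isLeafAt (s₂.comap φ) (fun t => ?_) (fun t ht => h.not_adj_of_adj ht) h₁
    (IsLeafAt.comap φ.toEquiv (e.isLeafAt_induce hyz)) ((dist_eq _ _).symm ▸ hu) h.not_adj
  exact (e.dist_induce_center_le_one_iff hyz r₂ (φ t)).symm.trans
    (iff_of_eq (congrArg (· ≤ 1) (dist_eq (φ.symm ⟨z, e.ne.symm⟩) t).symm))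

theorem IsFarPair.not_crossLinked (h : IsFarPair H v v') (hroot : HasSimplicialCardRoots H)
    {u : V} (hu : IsSimplicial H u) (hvu : ¬H.Adj v u) (hv'u : ¬H.Adj v' u) (huv : u ≠ v)
    (huv' : u ≠ v') :
    ¬CrossLinked H (H.neighborSet v) (H.neighborSet v') := by
  obtain ⟨T, r, -⟩ := hroot u hu
  lift v to ({u}ᶜ : Set V) using huv.symm
  lift v' to ({u}ᶜ : Set V) using huv'.symm
  have subset : ∀ {t}, ¬H.Adj t u → H.neighborSet t ⊆ {u}ᶜ := by
    rintro t ht _ htu rfl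
    exact ht htu
  rw [← crossLinked_induce_iff (subset hvu) (subset hv'u)]
  exact r.not_crossLinked (h.of_induce.seven_le_dist r)

theorem IsFarPair.isRootBall [Finite V] (h : IsFarPair H v v')
    (hroot : HasSimplicialCardRoots H) :
    IsRootBall (H.induce {v}ᶜ) (Subtype.val ⁻¹' H.neighborSet v) := by
  obtain ⟨T₁, r₁, h₁⟩ := hroot v h.isSimplicial_left
  obtain ⟨T₂, r₂, h₂⟩ := hroot v' h.isSimplicial_right
  obtain ⟨y, z, e⟩ := r₂.exists_isEndLeaf_of_diam
    (h.isSimplicial_left.induce {v'}ᶜ h.ne) (by omega)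
  by_cases hyz : ∃ s, T₂.Adj y s ∧ s ≠ z ∧ s ≠ ⟨v, h.ne⟩
  · obtain ⟨s, hys, hsz, hsv⟩ := hyz
    have htwin := (e.forall_dist_le_three_iff r₂.isTree).2 ⟨hys, hsz⟩
    have hsv' : (H.induce {v'}ᶜ).Adj s ⟨v, h.ne⟩ :=
      r₂.adj_iff.2 ⟨hsv, (T₂.dist_comm).trans_le ((htwin s).1 (by simp))⟩
    have htwin' : IsTwin (H.induce {v'}ᶜ) s ⟨v, h.ne⟩ := fun t hts htv => by
      rw [r₂.adj_iff, r₂.adj_iff, htwin, and_iff_right hts.symm, and_iff_right htv.symm]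
    exact isRootBall_of_isTwin r₁ (by omega) h.isSimplicial_left
      (htwin'.of_induce (h.not_adj_of_adj (H.adj_symm hsv')) fun hv => h.not_adj hv.symm) hsv'
  · push Not at hyz
    refine (h.isRootBall_or r₁ h₁ r₂ h₂ e hyz).resolve_right ?_
    rintro ⟨hlinked, u, huv', hu, hvu, hv'u⟩
    refine h.not_crossLinked hroot (hu.of_induce hvu) hvu hv'u u.2
      (fun heq => huv' (Subtype.ext heq)) ((crossLinked_induce_iff ?_ ?_).1 hlinked)
    · exact fun t ht => ht.ne'
    · exact fun t ht htv => h.not_adj (htv ▸ ht).symm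

theorem IsFarPair.exists_isCubeRoot [Finite V] (h : IsFarPair H v v')
    (hroot : HasSimplicialCardRoots H) : ∃ T, IsCubeRoot T H :=
  (h.isRootBall hroot).exists_isCubeRoot

end DeleteTwo

section FarPair

variable {V : Type*} {H : SimpleGraph V} {v : V} {T : SimpleGraph ({v}ᶜ : Set V)}

theorem isFarPair_of_adj (r : IsCubeRoot T (H.induce {v}ᶜ)) (hv : IsSimplicial H v)
    {a b : ({v}ᶜ : Set V)} (ha : H.Adj v a) (hb : IsSimplicial (H.induce {v}ᶜ) b)
    (hab : 4 ≤ T.dist a b)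
    (h : ∀ t : ({v}ᶜ : Set V), H.Adj v t → T.dist a t ≤ 3 → ¬T.dist b t ≤ 3) :
    IsFarPair H v b := by
  have hne : a ≠ b := by rintro rfl; simp at hab
  have hvb : ¬H.Adj v b := fun hvb => by
    have := r.dist_le (hv.adj ha hvb (Subtype.coe_injective.ne hne))
    omega
  refine ⟨hv, hb.of_induce hvb, Ne.symm b.2, hvb, fun t hvt hbt => ?_⟩
  lift t to ({v}ᶜ : Set V) using hvt.ne'
  refine h t hvt ?_ (r.dist_le hbt)
  obtain rfl | hat := eq_or_ne a t
  · simp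
  · exact r.dist_le (hv.adj ha hvt (Subtype.coe_injective.ne hat))

theorem exists_isFarPair_of_seven_le_diam [Finite V] (r : IsCubeRoot T (H.induce {v}ᶜ))
    (hv : IsSimplicial H v) (h : 7 ≤ T.diam) : ∃ a b, IsFarPair H a b := by
  obtain ⟨a, b, hab, ha, hb⟩ := r.exists_isSimplicial_pair
  have hle : ∀ t, T.dist a t ≤ 3 → ¬T.dist b t ≤ 3 := fun t hat hbt => by
    have := r.isTree.connected.dist_triangle (u := a) (v := t) (w := b)
    have := T.dist_comm (u := b) (v := t)
    omega
  by_cases hva : H.Adj v a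
  · exact ⟨v, b, isFarPair_of_adj r hv hva hb (by omega) fun t _ => hle t⟩
  by_cases hvb : H.Adj v b
  · refine ⟨v, a, isFarPair_of_adj r hv hvb ha ?_ fun t _ hbt hat => hle t hat hbt⟩
    rw [T.dist_comm]
    omega
  refine ⟨a, b, ha.of_induce hva, hb.of_induce hvb, ?_, fun hadj => ?_, fun t hat hbt => ?_⟩
  · intro heq
    obtain rfl := Subtype.ext heq
    simp at hab
    omega
  · have := r.dist_le hadj
    omega
  · lift t to ({v}ᶜ : Set V) using fun htv => hva (htv ▸ hat.symm)
    exact hle t (r.dist_le hat) (r.dist_le hbt)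

theorem not_dist_le_three_of_adj (r : IsCubeRoot T (H.induce {v}ᶜ)) (huniv : ∀ u, ¬H.IsUniversal u)
    {a b c t : ({v}ᶜ : Set V)} (hab : T.dist a b = 6) (hc : ∀ t, T.dist c t ≤ 3) (hvt : H.Adj v t)
    (hat : T.dist a t ≤ 3) : ¬T.dist b t ≤ 3 := by
  intro hbt
  have between : ∀ s, T.dist a s ≤ 3 → T.dist b s ≤ 3 → T.dist a s = 3 ∧ T.dist s b = 3 := by
    intro s has hbs
    have := r.isTree.connected.dist_triangle (u := a) (v := s) (w := b)
    have := T.dist_comm (u := b) (v := s)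
    omega
  have ht := between t hat hbt
  have hc' := between c (T.dist_comm ▸ hc a) (T.dist_comm ▸ hc b)
  obtain rfl : t = c := eq_of_between (u := a) (v := b) r.isTree (by omega) (by omega) (by omega)
  refine huniv t fun s hts => ?_
  obtain rfl | hsv := eq_or_ne s v
  · exact hvt.symm
  · lift s to ({v}ᶜ : Set V) using hsv
    exact r.adj_iff.2 ⟨fun h => hts (congrArg _ h), hc s⟩

theorem exists_isFarPair_of_forall_eq_or_eq [Finite V] {v' : V} (r : IsCubeRoot T (H.induce {v}ᶜ))
    (hv : IsSimplicial H v) (h : 6 ≤ T.diam) (hsimp : ∀ u, IsSimplicial H u → u = v ∨ u = v')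
    (huniv : ∀ u, ¬H.IsUniversal u) : ∃ a b, IsFarPair H a b := by
  obtain h7 | h6 := h.lt_or_eq
  · exact exists_isFarPair_of_seven_le_diam r hv h7
  obtain ⟨a, b, hab, ha, hb⟩ := r.exists_isSimplicial_pair
  obtain ⟨c, hc⟩ := exists_forall_dist_le r.isTree (n := 3) (by omega)
  have center : ∀ t : ({v}ᶜ : Set V), H.Adj v t → T.dist a t ≤ 3 → ¬T.dist b t ≤ 3 := fun _ =>
    not_dist_le_three_of_adj r huniv (by omega) hc
  by_cases hva : H.Adj v a
  · exact ⟨v, b, isFarPair_of_adj r hv hva hb (by omega) center⟩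
  by_cases hvb : H.Adj v b
  · refine ⟨v, a, isFarPair_of_adj r hv hvb ha ?_ fun t hvt hbt hat => center t hvt hat hbt⟩
    rw [T.dist_comm]
    omega
  have hav' := (hsimp a (ha.of_induce hva)).resolve_left a.2
  have hbv' := (hsimp b (hb.of_induce hvb)).resolve_left b.2
  obtain rfl : a = b := Subtype.ext (hav'.trans hbv'.symm)
  simp at hab
  omega

end FarPair

section CliqueCount

variable {V W : Type*} {G : SimpleGraph V} {H : SimpleGraph W} {k : ℕ}

theorem ncard_cliqueSet_congr (e : G ≃g H) (k : ℕ) :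
    (G.cliqueSet k).ncard = (H.cliqueSet k).ncard := by
  have hmap : G.map e.toEquiv = H := by
    ext a b
    obtain ⟨a, rfl⟩ := e.surjective a
    obtain ⟨b, rfl⟩ := e.surjective b
    rw [e.map_adj_iff]
    exact map_adj_apply (f := e.toEquiv.toEmbedding)
  rw [← hmap, cliqueSet_map_of_equiv, Set.ncard_image_of_injective _ (Finset.map_injective _)]

theorem ncard_cliqueSet_induce_compl (G : SimpleGraph V) (k : ℕ) (x : V) :
    ((G.induce {x}ᶜ).cliqueSet k).ncard = (G.cliqueSet k \ {s | x ∈ s}).ncard := by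
  classical
  rw [← Set.ncard_image_of_injective _ (Finset.map_injective (.subtype (· ∈ ({x}ᶜ : Set V))))]
  congr 1
  ext s
  constructor
  · rintro ⟨t, ht, rfl⟩
    exact ⟨(isNClique_induce_iff _ _ _).1 ht, by simp⟩
  · rintro ⟨hs, hx⟩
    have hmap := Finset.subtype_map_of_mem (s := s) (p := (· ∈ ({x}ᶜ : Set V)))
      (by rintro y hy rfl; exact hx hy)
    exact ⟨_, (isNClique_induce_iff _ _ _).2 (hmap.symm ▸ hs), hmap⟩

/-- The `k`-cliques of `G` that contain `x`. -/
def cliquesThrough (G : SimpleGraph V) (k : ℕ) (x : V) : Set (Finset V) :=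
  G.cliqueSet k ∩ {s | x ∈ s}

theorem ncard_cliquesThrough_add [Finite V] (x : V) :
    (cliquesThrough G k x).ncard + ((G.induce {x}ᶜ).cliqueSet k).ncard = (G.cliqueSet k).ncard := by
  rw [ncard_cliqueSet_induce_compl]
  exact Set.ncard_inter_add_ncard_sdiff_eq_ncard _ _

theorem sum_ncard_cliqueSet_induce [Fintype V] (G : SimpleGraph V) (k : ℕ) :
    ∑ x, ((G.induce {x}ᶜ).cliqueSet k).ncard =
      (G.cliqueSet k).ncard * (Fintype.card V - k) := by
  classical
  have hcount := Finset.sum_card_bipartiteAbove_eq_sum_card_bipartiteBelow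
    (s := (Finset.univ : Finset V)) (t := G.cliqueFinset k) (fun x s => x ∉ s)
  calc ∑ x, ((G.induce {x}ᶜ).cliqueSet k).ncard
      = ∑ x, ((G.cliqueFinset k).filter (x ∉ ·)).card := by
        refine Finset.sum_congr rfl fun x _ => ?_
        rw [ncard_cliqueSet_induce_compl, ← Set.ncard_coe_finset]
        congr 1
        ext s
        simp
    _ = ∑ s ∈ G.cliqueFinset k, (Finset.univ.filter (· ∉ s)).card := hcount
    _ = (G.cliqueFinset k).card * (Fintype.card V - k) := by
        refine Finset.sum_const_nat fun s hs => ?_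
        rw [← ((mem_cliqueFinset_iff).1 hs).card_eq, ← Finset.card_compl]
        congr 1
        ext x
        simp
    _ = _ := by rw [← Set.ncard_coe_finset, coe_cliqueFinset]

theorem ncard_neighborSet_eq (x : V) :
    (G.neighborSet x).ncard = (cliquesThrough G 2 x).ncard := by
  classical
  refine Set.ncard_congr (fun y _ => {x, y}) ?_ ?_ ?_
  · intro y hy
    have hxy : G.Adj x y := hy
    simp [cliquesThrough, isNClique_iff, hxy, hxy.ne, Finset.card_pair hxy.ne]
  · intro y z hy _ hyz
    have hxy : G.Adj x y := hy
    have : y ∈ ({x, z} : Finset V) := hyz ▸ by simp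
    simpa [hxy.ne'] using this
  · rintro s ⟨hs, hx⟩
    obtain ⟨a, b, hab, rfl⟩ := Finset.card_eq_two.1 hs.card_eq
    have hadj : G.Adj a b := hs.isClique (by simp) (by simp) hab
    obtain rfl | rfl : x = a ∨ x = b := by simpa using hx
    · exact ⟨b, hadj, rfl⟩
    · exact ⟨a, hadj.symm, Finset.pair_comm _ _⟩

theorem isSimplicial_iff_cliquesThrough_nonempty [Finite V] (x : V) :
    IsSimplicial G x ↔ (cliquesThrough G ((G.neighborSet x).ncard + 1) x).Nonempty := by
  classical
  have := Fintype.ofFinite V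
  have hx : x ∉ G.neighborFinset x := G.notMem_neighborFinset_self x
  rw [← coe_neighborFinset, Set.ncard_coe_finset, ← Finset.card_insert_of_notMem hx]
  have hins : IsSimplicial G x ↔ G.IsClique (insert x (G.neighborFinset x)) := by
    rw [isClique_insert, coe_neighborFinset]
    exact (and_iff_left fun b hb _ => hb).symm
  constructor
  · exact fun h => ⟨insert x (G.neighborFinset x), ⟨by simpa using hins.1 h, rfl⟩, by simp⟩
  · rintro ⟨s, hs, hxs⟩
    have hsub : s ⊆ insert x (G.neighborFinset x) := fun y hy => by
      by_cases hxy : x = y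
      · simp [hxy]
      · simp [hs.isClique hxs hy hxy]
    rw [hins, ← Finset.coe_insert, ← Finset.eq_of_subset_of_card_le hsub hs.card_eq.ge]
    exact hs.isClique

theorem isUniversal_iff_ncard_neighborSet [Finite V] (x : V) :
    G.IsUniversal x ↔ (G.neighborSet x).ncard + 1 = Nat.card V := by
  have hx : x ∉ G.neighborSet x := G.notMem_neighborSet_self
  rw [← Set.ncard_insert_of_notMem hx, ← Set.eq_univ_iff_ncard, insert_neighborSet_eq_univ]

end CliqueCount

section Deck

variable {V W : Type*} {G : SimpleGraph V} {H : SimpleGraph W} {σ : V ≃ W} {x : V} {k : ℕ}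

/-- The bijection `σ` witnesses that `G` and `H` have the same deck: it matches isomorphic cards. -/
def IsCardMatching (G : SimpleGraph V) (H : SimpleGraph W) (σ : V ≃ W) : Prop :=
  ∀ x, Nonempty (G.induce {x}ᶜ ≃g H.induce {σ x}ᶜ)

theorem exists_equiv_of_map_univ_eq [Fintype V] [Fintype W] {α : Type*} {f : V → α} {g : W → α}
    (h : (Finset.univ : Finset V).val.map f = (Finset.univ : Finset W).val.map g) :
    ∃ σ : V ≃ W, ∀ x, g (σ x) = f x := by
  classical
  have hfiber : ∀ c, Nonempty ({a // f a = c} ≃ {b // g b = c}) := by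
    intro c
    have hcount := congrArg (Multiset.count c) h
    rw [Multiset.count_map, Multiset.count_map] at hcount
    refine Fintype.card_eq.1 ?_
    rw [Fintype.card_subtype, Fintype.card_subtype]
    simp only [Finset.card_def, Finset.filter_val]
    simpa only [eq_comm] using hcount
  exact ⟨Equiv.ofFiberEquiv fun c => (hfiber c).some, Equiv.ofFiberEquiv_map _⟩

theorem exists_isCardMatching [Fintype V] [Fintype W] (h : deck G = deck H) :
    ∃ σ, IsCardMatching G H σ := by
  obtain ⟨σ, hσ⟩ := exists_equiv_of_map_univ_eq h
  exact ⟨σ, fun x => (unlabelled_eq_iff _ _).1 (hσ x).symm⟩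

theorem nonempty_iso_of_isUniversal {y : W} (hx : G.IsUniversal x) (hy : H.IsUniversal y)
    (e : G.induce {x}ᶜ ≃g H.induce {y}ᶜ) : Nonempty (G ≃g H) := by
  classical
  let f : Option ({x}ᶜ : Set V) ≃ V := Equiv.optionSubtypeNe x
  let g : Option ({y}ᶜ : Set W) ≃ W := Equiv.optionSubtypeNe y
  have key : ∀ a b, H.Adj (g (a.map e)) (g (b.map e)) ↔ G.Adj (f a) (f b) := by
    rintro (_ | a) (_ | b)
    · exact iff_of_false H.irrefl G.irrefl
    · exact iff_of_true (hy (Ne.symm (e b).2)) (hx (Ne.symm b.2))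
    · exact iff_of_true (hy (Ne.symm (e a).2)).symm (hx (Ne.symm a.2)).symm
    · exact e.map_adj_iff
  refine ⟨⟨f.symm.trans (e.toEquiv.optionCongr.trans g), fun {a b} => ?_⟩⟩
  simpa using key (f.symm a) (f.symm b)

namespace IsCardMatching

theorem symm (hσ : IsCardMatching G H σ) : IsCardMatching H G σ.symm := fun y => by
  obtain ⟨e⟩ := hσ (σ.symm y)
  rw [σ.apply_symm_apply] at e
  exact ⟨e.symm⟩

theorem ncard_cliquesThrough [Finite V] (hσ : IsCardMatching G H σ) (hk : k < Nat.card V) (x : V) :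
    (cliquesThrough G k x).ncard = (cliquesThrough H k (σ x)).ncard := by
  have := Finite.of_equiv V σ
  have := Fintype.ofFinite V
  have := Fintype.ofFinite W
  have hcard : ∀ x, ((G.induce {x}ᶜ).cliqueSet k).ncard = ((H.induce {σ x}ᶜ).cliqueSet k).ncard :=
    fun x => ncard_cliqueSet_congr (hσ x).some k
  have htotal : (G.cliqueSet k).ncard = (H.cliqueSet k).ncard := by
    have hsum := Fintype.sum_equiv σ _ (fun y => ((H.induce {y}ᶜ).cliqueSet k).ncard) hcard
    rw [sum_ncard_cliqueSet_induce, sum_ncard_cliqueSet_induce, ← Fintype.card_congr σ] at hsum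
    rw [Nat.card_eq_fintype_card] at hk
    exact Nat.eq_of_mul_eq_mul_right (Nat.sub_pos_of_lt hk) hsum
  have hG := ncard_cliquesThrough_add (G := G) (k := k) x
  have hH := ncard_cliquesThrough_add (G := H) (k := k) (σ x)
  have := hcard x
  omega

variable [Finite V]

theorem ncard_neighborSet (hσ : IsCardMatching G H σ) (hV : 3 ≤ Nat.card V) (x : V) :
    (G.neighborSet x).ncard = (H.neighborSet (σ x)).ncard := by
  rw [ncard_neighborSet_eq, ncard_neighborSet_eq, hσ.ncard_cliquesThrough hV]

theorem isUniversal_iff (hσ : IsCardMatching G H σ) (hV : 3 ≤ Nat.card V) :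
    G.IsUniversal x ↔ H.IsUniversal (σ x) := by
  have := Finite.of_equiv V σ
  rw [isUniversal_iff_ncard_neighborSet, isUniversal_iff_ncard_neighborSet,
    hσ.ncard_neighborSet hV, Nat.card_congr σ]

theorem isSimplicial_iff (hσ : IsCardMatching G H σ) (hV : 3 ≤ Nat.card V)
    (hx : ¬G.IsUniversal x) : IsSimplicial G x ↔ IsSimplicial H (σ x) := by
  have := Finite.of_equiv V σ
  have hlt : (G.neighborSet x).ncard + 1 < Nat.card V :=
    lt_of_le_of_ne (Set.ncard_lt_card (Set.ne_univ_iff_exists_notMem _ |>.2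
      ⟨x, G.notMem_neighborSet_self⟩)) ((isUniversal_iff_ncard_neighborSet x).not.1 hx)
  rw [isSimplicial_iff_cliquesThrough_nonempty, isSimplicial_iff_cliquesThrough_nonempty,
    ← Set.ncard_pos, ← Set.ncard_pos, hσ.ncard_cliquesThrough hlt, hσ.ncard_neighborSet hV]

end IsCardMatching

namespace IsCardMatching

variable [Finite V] {T : SimpleGraph V} (hσ : IsCardMatching G H σ) (r : IsCubeRoot T G)
  (hdiam : 7 ≤ T.diam)
include hσ r hdiam

theorem exists_isCubeRoot_card (hx : IsSimplicial G x) :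
    ∃ T', IsCubeRoot T' (H.induce {σ x}ᶜ) ∧ (T.induce {x}ᶜ).diam ≤ T'.diam := by
  obtain ⟨p, hp⟩ := r.exists_isLeafAt hx (by omega)
  obtain ⟨e⟩ := hσ x
  have s := r.induce hp
  exact ⟨_, s.comap e.symm, diam_le_diam_comap_equiv s.isTree e.symm.toEquiv⟩

variable (hV : 3 ≤ Nat.card V) (hG : ∀ x, ¬G.IsUniversal x)
include hV hG

theorem hasSimplicialCardRoots : HasSimplicialCardRoots H := by
  intro v hv
  obtain ⟨x, rfl⟩ := σ.surjective v
  have hx := (hσ.isSimplicial_iff hV (hG x)).2 hv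
  obtain ⟨p, hp⟩ := r.exists_isLeafAt hx (by omega)
  obtain ⟨T', r', h'⟩ := hσ.exists_isCubeRoot_card r hdiam hx
  have := hp.diam_le r.isTree
  exact ⟨T', r', by omega⟩

theorem exists_isFarPair : ∃ a b, IsFarPair H a b := by
  have := Finite.of_equiv V σ
  have isSimplicial_iff : ∀ x, IsSimplicial G x ↔ IsSimplicial H (σ x) := fun x =>
    hσ.isSimplicial_iff hV (hG x)
  obtain ⟨a, b, hab, ha, -⟩ := r.exists_isSimplicial_pair
  by_cases hthird : ∃ x, IsSimplicial G x ∧ a ≠ x ∧ b ≠ x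
  · obtain ⟨x, hx, hax, hbx⟩ := hthird
    obtain ⟨p, hp⟩ := r.exists_isLeafAt hx (by omega)
    obtain ⟨T', r', h'⟩ := hσ.exists_isCubeRoot_card r hdiam hx
    have hS := hp.isTree_induce r.isTree
    have hle := dist_le_diam_of_isTree hS ⟨a, hax⟩ ⟨b, hbx⟩
    rw [dist_induce r.isTree hS.connected, hab] at hle
    exact exists_isFarPair_of_seven_le_diam r' ((isSimplicial_iff x).1 hx) (by omega)
  · push Not at hthird
    obtain ⟨T', r', h'⟩ := hσ.hasSimplicialCardRoots r hdiam hV hG _ ((isSimplicial_iff a).1 ha)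
    refine exists_isFarPair_of_forall_eq_or_eq (v' := σ b) r' ((isSimplicial_iff a).1 ha) h'
      (fun u hu => ?_) fun u hu => ?_
    · obtain ⟨x, rfl⟩ := σ.surjective u
      exact (eq_or_ne a x).imp (congrArg σ ·.symm)
        fun hax => congrArg σ (hthird x ((isSimplicial_iff x).2 hu) hax).symm
    · obtain ⟨x, rfl⟩ := σ.surjective u
      exact hG x ((hσ.isUniversal_iff hV).2 hu)

end IsCardMatching

theorem IsCardMatching.isCubeOfTree [Finite V] (hσ : IsCardMatching G H σ) (hV : 3 ≤ Nat.card V)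
    (hG : IsCubeOfTree G) : IsCubeOfTree H := by
  have := Finite.of_equiv V σ
  obtain ⟨T, r⟩ := isCubeOfTree_iff.1 hG
  rw [isCubeOfTree_iff]
  by_cases huniv : ∃ x, G.IsUniversal x
  · obtain ⟨x, hx⟩ := huniv
    obtain ⟨φ⟩ := nonempty_iso_of_isUniversal hx ((hσ.isUniversal_iff hV).1 hx) (hσ x).some
    exact ⟨_, r.comap φ.symm⟩
  · push Not at huniv
    have hdiam := r.seven_le_diam huniv
    obtain ⟨a, b, h⟩ := hσ.exists_isFarPair r hdiam hV huniv
    exact h.exists_isCubeRoot (hσ.hasSimplicialCardRoots r hdiam hV huniv)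

end Deck

end TreeCube

theorem lemma4p2 {V : Type*} {W : Type*} [Fintype V] [Fintype W]
    (G : SimpleGraph V) (H : SimpleGraph W)
    (hV : 3 ≤ Fintype.card V)
    (hdeck : TreeCube.deck G = TreeCube.deck H) :
    TreeCube.IsCubeOfTree G ↔ TreeCube.IsCubeOfTree H := by
  obtain ⟨σ, hσ⟩ := TreeCube.exists_isCardMatching hdeck
  rw [← Nat.card_eq_fintype_card] at hV
  exact ⟨hσ.isCubeOfTree hV, hσ.symm.isCubeOfTree (Nat.card_congr σ ▸ hV)⟩
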